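/- Let $L\ge1$, $c\in\mathbb C\setminus\{0\}$, $s_1,\dots,s_L\in\mathbb C$. For each boundary $\pm$ let $\xi^\pm\neq0$, $\kappa^\pm\ne0$, $\theta^\pm,\alpha^\pm,\beta^\pm\in\mathbb C$ with $\alpha^\pm\cosh\beta^\pm=\xi^\pm/(2\kappa^\pm)$ and $\sinh\beta^\pm=1/(2\kappa^\pm)$. Put $$K^\pm(\lambda)=\frac1{\xi^\pm}\begin{pmatrix}\xi^\pm+\lambda&2\kappa^\pm e^{\theta^\pm}\lambda\\2\kappa^\pm e^{-\theta^\pm}\lambda&\xi^\pm-\lambda\end{pmatrix},\qquad G=\begin{pmatrix}e^{\theta^+/2}&0\\0&e^{-\theta^+/2}\end{pmatrix}\frac1{\sqrt{2\cosh\beta^+}}\begin{pmatrix}e^{\beta^+/2}&-e^{-\beta^+/2}\\e^{-\beta^+/2}&e^{\beta^+/2}\end{pmatrix}.$$ On $W=(\mathbb C^2)^{\otimes L}$ let $T(\lambda)=L_L(\lambda)\cdots L_1(\lambda)$ with $L_j(\lambda)=\lambda-s_j+ic\,P_{0j}$, where $P_{0j}$ permutes the auxiliary space $0$ and site $j$.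 For a monodromy matrix $T$ put $U_T(\lambda)=T(\lambda-\tfrac{ic}2)K^-(\lambda-\tfrac{ic}2)\sigma^yT^t(-\lambda-\tfrac{ic}2)\sigma^y$ ($t$ is the transposition in auxiliary space). The transfer matrix of the open XXX chain is $\tau(\lambda)=\tfrac12\operatorname{tr}K^+(\lambda+\tfrac{ic}2)U_T(\lambda)$. Let $\mathcal A,\mathcal B,\mathcal C,\mathcal D$ be the entries of $U_{G^{-1}T}$, and $\widetilde{\mathcal D}(\lambda)=2\lambda\mathcal D(\lambda)-ic\mathcal A(\lambda)$, $\widetilde{\mathcal C}(\lambda)=(2\lambda+ic)\mathcal C(\lambda)$. Define $$\Delta^-(\lambda)=\frac{\lambda-\frac{ic}2+\alpha^-}{(-1)^L\alpha^-}\prod_{l=1}^L(\lambda-s_l+\tfrac{ic}2)(\lambda+s_l+\tfrac{ic}2),$$ $$\Delta^+(\lambda)=-(2\lambda-ic)\frac{\lambda+\frac{ic}2-\alpha^-}{(-1)^L\alpha^-}\prod_{l=1}^L(\lambda-s_l-\tfrac{ic}2)(\lambda+s_l-\tfrac{ic}2),$$ $\Delta_q(\lambda)=\Delta^-(\lambda+\tfrac{ic}2)\Delta^+(\lambda-\tfrac{ic}2)$,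 $\Lambda_j=\{s_j-\tfrac{ic}2,s_j+\tfrac{ic}2\}$, $\mathbb X^L=\Lambda_1\times\dots\times\Lambda_L$, and $k=-\dfrac{1-2\kappa^-\sinh(\theta^--\theta^++\beta^+)}{(-1)^L\xi^-\,2\cosh\beta^+}$. An eigenvalue of $\tau$ is a function $\Lambda(\lambda)$ for which there is $\psi\in W\setminus\{0\}$, independent of $\lambda$, with $\tau(\lambda)\psi=\Lambda(\lambda)\psi$ for all $\lambda$. Then: 1. $\Delta_q$ is the quantum determinant: $\mathcal A(\lambda+\tfrac{ic}2)\widetilde{\mathcal D}(\lambda-\tfrac{ic}2)-\mathcal B(\lambda+\tfrac{ic}2)\widetilde{\mathcal C}(\lambda-\tfrac{ic}2)=\Delta_q(\lambda)\cdot 1$ for all $\lambda$. 2. Suppose that $k\ne0$; that $x^2\neq y^2$ for $x\in\Lambda_j$, $y\in\Lambda_l$, $j\ne l$; that no $\Lambda_j$ contains $0$, $\tfrac{ic}2$ or $-\tfrac{ic}2$; and that $s_j\ne\pm\alpha^-$ for all $j$. Then there is a linear isomorphism $\Phi$ from $W$ onto the functions on $\mathbb X^L$ (separated variables) such that for all $\psi\in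 W$, $x\in\mathbb X^L$, $j$ and $\lambda$, $$(\Phi\mathcal B(\lambda)\psi)(x)=k(2\lambda-ic)\prod_{l}(\lambda^2-x_l^2)\,(\Phi\psi)(x),$$ $$(\Phi\mathcal A(x_j)\psi)(x)=\Delta^-(x_j)(\Phi\psi)(\dots,x_j-ic,\dots),\qquad(\Phi\widetilde{\mathcal D}(x_j)\psi)(x)=\Delta^+(x_j)(\Phi\psi)(\dots,x_j+ic,\dots),$$ where values off $\mathbb X^L$ are read as $0$ (their coefficients $\Delta^\pm(x_j)$ vanish). Moreover, for each eigenvalue $\Lambda$ with eigenvector $\psi$ there is a function $Q$ with $(\Phi\psi)(x)=\prod_{l=1}^LQ(x_l)$ on $\mathbb X^L$, and for all $j$ and all $x_j\in\Lambda_j$ the TQ-equation holds: $$\Lambda(x_j)Q(x_j)=\frac{(x_j+\frac{ic}2)(x_j+\alpha^+-\frac{ic}2)}{2x_j\alpha^+}\Delta^-(x_j)Q(x_j-ic)-\frac{x_j-\alpha^++\frac{ic}2}{4x_j\alpha^+}\Delta^+(x_j)Q(x_j+ic).$$ 3. Without the non-degeneracy assumptions of part 2, each eigenvalue satisfies, for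 each $j$ with $2s_j\neq\pm ic$, $$\Lambda(s_j+\tfrac{ic}2)\Lambda(s_j-\tfrac{ic}2)=-\frac{s_j+ic}{2}\,\frac{s_j-\alpha^+}{(2s_j-ic)\alpha^+}\,\frac{s_j+\alpha^+}{(2s_j+ic)\alpha^+}\,\Delta_q(s_j).$$ -/

import Mathlib

open Complex

noncomputable section

namespace OpenXXX

/-! Rational (XXX) open spin-1/2 chain with `L` sites, crossing parameter `η = i c`. -/

/-- Parameters of one boundary: `ξ, κ, θ` enter the boundary matrix, `α, β` are the factorizing
parameters, tied to `ξ, κ` by `Boundary.Admissible`. -/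
structure Boundary where
  ξ : ℂ
  κ : ℂ
  θ : ℂ
  α : ℂ
  β : ℂ

/-- Non-diagonal boundary (`κ ≠ 0`) together with the rational limit of
`sinh α cosh β = sinh ξ / (2κ)`, `cosh α sinh β = cosh ξ / (2κ)`. -/
structure Boundary.Admissible (b : Boundary) : Prop where
  ξ_ne : b.ξ ≠ 0
  κ_ne : b.κ ≠ 0
  α_cosh : b.α * cosh b.β = b.ξ / (2 * b.κ)
  sinh_β : sinh b.β = 1 / (2 * b.κ)

/-- The number-valued boundary matrix `K(z, ξ)` in the rational limit. -/
def Boundary.K (b : Boundary) (z : ℂ) : Matrix (Fin 2) (Fin 2) ℂ :=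
  !![1 + z / b.ξ, 2 * b.κ * exp b.θ * z / b.ξ;
     2 * b.κ * exp (-b.θ) * z / b.ξ, 1 - z / b.ξ]

/-- The diagonal matrix `M`. -/
def Boundary.M (b : Boundary) : Matrix (Fin 2) (Fin 2) ℂ :=
  !![exp (b.θ / 2), 0; 0, exp (-b.θ / 2)]

/-- The matrix `S`; the boundary matrix is `K(z) = (M S) diag(1 + z/α, 1 - z/α) (M S)⁻¹`. -/
def Boundary.S (b : Boundary) : Matrix (Fin 2) (Fin 2) ℂ :=
  ((2 * cosh b.β) ^ (1 / 2 : ℂ))⁻¹ •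
    !![exp (b.β / 2), -exp (-b.β / 2); exp (-b.β / 2), exp (b.β / 2)]

/-- The quantum space `(ℂ²)^{⊗ L}`, in the standard product basis. -/
abbrev Space (L : ℕ) : Type := (Fin L → Fin 2) → ℂ

/-- Operators on the quantum space. -/
abbrev Op (L : ℕ) : Type := Matrix (Fin L → Fin 2) (Fin L → Fin 2) ℂ

/-- 2×2 matrices in auxiliary space with operator entries. -/
abbrev AuxOp (L : ℕ) : Type := Matrix (Fin 2) (Fin 2) (Op L)

variable {L : ℕ}

/-- The 2×2 matrix `m` acting on the `j`-th tensor factor, identity on the others. -/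
def siteOp (j : Fin L) (m : Matrix (Fin 2) (Fin 2) ℂ) : Op L :=
  fun a b => m (a j) (b j) * (if ∀ k, k ≠ j → a k = b k then 1 else 0)

/-- A number matrix in auxiliary space, acting trivially in quantum space. -/
def scal (m : Matrix (Fin 2) (Fin 2) ℂ) : AuxOp L :=
  fun a b => m a b • (1 : Op L)

/-- The local matrix `L_j(z) = (z - s_j) + i c P_{0j}`, `P_{0j} = ∑ e_{ab} ⊗ e_{ba}` being the
permutation of the auxiliary space and the `j`-th site. -/
def localL (c : ℂ) (s : Fin L → ℂ) (j : Fin L) (z : ℂ) : AuxOp L :=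
  fun a b => ((z - s j) * (if a = b then 1 else 0)) • (1 : Op L)
    + (I * c) • siteOp j (Matrix.single b a 1)

/-- The periodic monodromy matrix `T(z) = L_L(z) ⋯ L_1(z)`. -/
def T (c : ℂ) (s : Fin L → ℂ) (z : ℂ) : AuxOp L :=
  (List.ofFn fun j => localL c s j z).reverse.prod

/-- The twisted periodic monodromy matrix `(M⁺ S⁺)⁻¹ T(z)`. -/
def twistedT (c : ℂ) (s : Fin L → ℂ) (bp : Boundary) (z : ℂ) : AuxOp L :=
  scal (bp.M * bp.S)⁻¹ * T c s z

/-- The Pauli matrix `σ^y`. -/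
def σy : Matrix (Fin 2) (Fin 2) ℂ := !![0, -I; I, 0]

/-- `T(z - η/2) K⁻(z - η/2) σ^y Tᵗ(-z - η/2) σ^y` for a monodromy matrix `T`, with `η = i c` and
`t` the transposition in auxiliary space only. -/
def dress (c : ℂ) (bm : Boundary) (Tm : ℂ → AuxOp L) (z : ℂ) : AuxOp L :=
  Tm (z - I * c / 2) * scal (bm.K (z - I * c / 2)) *
    (scal σy * Matrix.transpose (Tm (-z - I * c / 2)) * scal σy)

/-- The transfer matrix `τ(z) = ½ tr K⁺(z + η/2) U(z)` of the open chain, with the full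
non-diagonal matrices at both ends. -/
def τ (c : ℂ) (s : Fin L → ℂ) (bp bm : Boundary) (z : ℂ) : Op L :=
  (1 / 2 : ℂ) • Matrix.trace (scal (bp.K (z + I * c / 2)) * dress c bm (T c s) z)

/-- The matrix `U(z)` with entries `𝒜, ℬ, 𝒞, 𝒟`, built from the twisted monodromy matrix. -/
def U (c : ℂ) (s : Fin L → ℂ) (bp bm : Boundary) (z : ℂ) : AuxOp L :=
  dress c bm (twistedT c s bp) z

def opA (c : ℂ) (s : Fin L → ℂ) (bp bm : Boundary) (z : ℂ) : Op L := U c s bp bm z 0 0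

def opB (c : ℂ) (s : Fin L → ℂ) (bp bm : Boundary) (z : ℂ) : Op L := U c s bp bm z 0 1

/-- `𝒞~(z) = (2z + i c) 𝒞(z)`. -/
def opCt (c : ℂ) (s : Fin L → ℂ) (bp bm : Boundary) (z : ℂ) : Op L :=
  (2 * z + I * c) • U c s bp bm z 1 0

/-- `𝒟~(z) = 2z 𝒟(z) - i c 𝒜(z)`. -/
def opDt (c : ℂ) (s : Fin L → ℂ) (bp bm : Boundary) (z : ℂ) : Op L :=
  (2 * z) • U c s bp bm z 1 1 - (I * c) • U c s bp bm z 0 0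

/-- The quantum determinant of the reflection algebra, as an operator. -/
def qdetOp (c : ℂ) (s : Fin L → ℂ) (bp bm : Boundary) (z : ℂ) : Op L :=
  opA c s bp bm (z + I * c / 2) * opDt c s bp bm (z - I * c / 2)
    - opB c s bp bm (z + I * c / 2) * opCt c s bp bm (z - I * c / 2)

/-- `Δ⁻(z)`. -/
def Δm (c : ℂ) (s : Fin L → ℂ) (bm : Boundary) (z : ℂ) : ℂ :=
  (z - I * c / 2 + bm.α) / ((-1) ^ L * bm.α) *
    ∏ l, ((z - s l + I * c / 2) * (z + s l + I * c / 2))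

/-- `Δ⁺(z)`. -/
def Δp (c : ℂ) (s : Fin L → ℂ) (bm : Boundary) (z : ℂ) : ℂ :=
  -(2 * z - I * c) * ((z + I * c / 2 - bm.α) / ((-1) ^ L * bm.α)) *
    ∏ l, ((z - s l - I * c / 2) * (z + s l - I * c / 2))

/-- The scalar `Δ_q(z) = Δ⁻(z + i c/2) Δ⁺(z - i c/2)`. -/
def Δq (c : ℂ) (s : Fin L → ℂ) (bm : Boundary) (z : ℂ) : ℂ :=
  Δm c s bm (z + I * c / 2) * Δp c s bm (z - I * c / 2)

/-- `Λ_j = {s_j - i c/2, s_j + i c/2}`. -/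
def nodes (c : ℂ) (s : Fin L → ℂ) (j : Fin L) : Set ℂ :=
  {s j - I * c / 2, s j + I * c / 2}

/-- The lattice `𝕏^L = Λ_1 × ⋯ × Λ_L` of values of the separated variables. -/
def grid (c : ℂ) (s : Fin L → ℂ) : Set (Fin L → ℂ) :=
  {x | ∀ l, x l ∈ nodes c s l}

open Classical in
/-- The value of `f` at the point `x` with `x_j` shifted by `d`; zero off the lattice. -/
def shifted {c : ℂ} {s : Fin L → ℂ} (j : Fin L) (d : ℂ) (f : grid c s → ℂ) (x : grid c s) : ℂ :=
  if h : Function.update x.1 j (x.1 j + d) ∈ grid c s then f ⟨_, h⟩ else 0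

/-- The leading coefficient in `ℬ(z) = leadB (2z - i c) ∏ (z² - x̂_l²)`. -/
def leadB (L : ℕ) (bp bm : Boundary) : ℂ :=
  -((1 - 2 * bm.κ * sinh (bm.θ - bp.θ + bp.β)) / ((-1) ^ L * bm.ξ * (2 * cosh bp.β)))

/-- Non-degeneracy: `ℬ` has full degree, the lattice has no multiple points (in the squared
variables), it avoids the pole `0` and the remaining zeros `± i c/2`, and `Δ_q(s_j)` does
not vanish through its boundary factor. -/
structure Generic (c : ℂ) (s : Fin L → ℂ) (bp bm : Boundary) : Prop where
  leadB_ne : leadB L bp bm ≠ 0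
  nodes_sq_ne : ∀ j k, j ≠ k → ∀ x ∈ nodes c s j, ∀ y ∈ nodes c s k, x ^ 2 ≠ y ^ 2
  nodes_ne : ∀ j, ∀ x ∈ nodes c s j, x ≠ 0 ∧ x ≠ I * c / 2 ∧ x ≠ -(I * c / 2)
  s_ne_α : ∀ j, s j ≠ bm.α ∧ s j ≠ -bm.α

/-- `Φ` realizes the quantum space as functions of the separated variables: the operator zeros
`x̂_l` of `ℬ` are multiplication by `x_l`, and substituting `x̂_j` from the left in `𝒜` and `𝒟~`
gives `X_j^∓ = Δ^∓(x_j) E_j^∓` with `E_j^∓` the shift `x_j ↦ x_j ∓ i c`. As `x̂_j` is diagonal,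
substitution from the left, `∑ x̂_j^p P_p`, means evaluating `P(z)` at the number `z = x_j` before
reading off the value at the point `x`. -/
structure IsSeparated (c : ℂ) (s : Fin L → ℂ) (bp bm : Boundary)
    (Φ : Space L ≃ₗ[ℂ] (grid c s → ℂ)) : Prop where
  B_apply : ∀ (z : ℂ) (ψ : Space L) (x : grid c s),
    Φ ((opB c s bp bm z).mulVec ψ) x
      = leadB L bp bm * (2 * z - I * c) * (∏ l, (z ^ 2 - x.1 l ^ 2)) * Φ ψ x
  A_apply : ∀ (ψ : Space L) (x : grid c s) (j : Fin L),
    Φ ((opA c s bp bm (x.1 j)).mulVec ψ) x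
      = Δm c s bm (x.1 j) * shifted j (-(I * c)) (Φ ψ) x
  Dt_apply : ∀ (ψ : Space L) (x : grid c s) (j : Fin L),
    Φ ((opDt c s bp bm (x.1 j)).mulVec ψ) x
      = Δp c s bm (x.1 j) * shifted j (I * c) (Φ ψ) x

/-- `Λ` is an eigenvalue (a function of the spectral parameter) of the transfer matrix, with
eigenvector `ψ`, which does not depend on the spectral parameter. -/
def IsEigenpair (c : ℂ) (s : Fin L → ℂ) (bp bm : Boundary) (Λ : ℂ → ℂ) (ψ : Space L) : Prop :=
  ψ ≠ 0 ∧ ∀ z, (τ c s bp bm z).mulVec ψ = Λ z • ψ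

end OpenXXX

end

open Complex

noncomputable section

namespace OpenXXX

set_option linter.unusedSectionVars false

/-! Write η = ic. The double-row matrix is obtained from the boundary matrix K⁻ by dressing it with
one site at a time, U ↦ L(z - η/2 - s) U (-L(z - η/2 + s)). Three properties hold for K⁻, survive
the dressing by a site, and survive conjugation by a number matrix: the reflection equation, an
inversion relation U(z + η/2) U(η/2 - z) = f(z) with f scalar, and a parity relation linking U(z),
U(-z) and the trace of U(z). Since det G = 1, replacing T by G⁻¹T conjugates the double-row matrix
by G, so 𝒜, ℬ, 𝒞, 𝒟 inherit all three.

Parity turns 𝒟~(z) into (2z - η) 𝒜(-z), and 𝒞~ likewise into a multiple of 𝒞(-z). The quantum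
determinant is then the (0,0) entry of the inversion relation, and Δ⁻ is a factor of f in the sense
that Δ⁻(z + η/2) Δ⁻(η/2 - z) = f(z).

For the separation of variables one builds left eigenvectors of ℬ(z), common to all z. The tensor
power of the first row of G⁻¹ is one, with zeros s_l - η/2. By the reflection equation, 𝒜(μ) with μ²
= x_j² maps a left eigenvector with zeros x to one in which x_j² has become (μ - η)², or to 0. The
inversion relation shows that raising x_j from s_j - η/2 to s_j + η/2 can be undone, so no vector is
lost, and commutation of the 𝒜's on such covectors makes the order of raising irrelevant. The
resulting 2^L covectors have distinct eigenvalue functions, hence form a basis; pairing with them is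
Φ. A step off the lattice gives 0, for otherwise there would be too many independent eigenvectors.

Conjugation by G diagonalizes K⁺, so τ(z) is a combination of 𝒜(z) and 𝒟~(z), and the eigenvalue
problem becomes a two-point recurrence in each variable separately. In each direction at least one
recurrence coefficient is nonzero, which forces the eigenfunction to be a product and yields the
TQ-equation.

The functional equation needs no lattice. Sites outside the j-th are absorbed into K⁺, sites inside
it into K⁻, leaving a one-site problem with operator-valued boundary matrices. At z = s_j + η/2 and
z = η/2 - s_j one Lax matrix reduces to ηP, each transfer matrix factorizes into one operator per
side, and the two inversion relations make the product of the two scalar. Evenness of τ turns η/2 -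
s_j into s_j - η/2. -/

variable {L : ℕ}

/-! ### Dressing by a site: parity and inversion relations -/

section Abstract

variable {A : Type*} [Ring A] [Algebra ℂ A]

/-- The matrix `σ^y Mᵗ σ^y`, the transposition being that of the auxiliary space. -/
def adj (M : Matrix (Fin 2) (Fin 2) A) : Matrix (Fin 2) (Fin 2) A :=
  !![M 1 1, -M 0 1; -M 1 0, M 0 0]

/-- All entries of `M` commute with all entries of `N`. -/
def EntriesCommute (M N : Matrix (Fin 2) (Fin 2) A) : Prop :=
  ∀ a b c d, Commute (M a b) (N c d)

/-- `P` is the permutation of the auxiliary space with a copy of `ℂ²` on which `A` acts: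
`P a b` are matrix units `e_{ba}`. -/
structure IsPerm (P : Matrix (Fin 2) (Fin 2) A) : Prop where
  mul : ∀ a b c d, P a b * P c d = if a = d then P c b else 0
  one : P 0 0 + P 1 1 = 1

/-- The local matrix `u + η P`. -/
def lax (η : ℂ) (P : Matrix (Fin 2) (Fin 2) A) (u : ℂ) : Matrix (Fin 2) (Fin 2) A :=
  u • 1 + η • P

/-- The value in `A` of a matrix `U` when the auxiliary space is identified with the site of `P`. -/
def hat (P U : Matrix (Fin 2) (Fin 2) A) : A := ∑ b, ∑ c, U b c * P c b

theorem EntriesCommute.symm {M N : Matrix (Fin 2) (Fin 2) A} (h : EntriesCommute M N) :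
    EntriesCommute N M := fun a b c d => (h c d a b).symm

theorem EntriesCommute.mul_right {M N N' : Matrix (Fin 2) (Fin 2) A} (h : EntriesCommute M N)
    (h' : EntriesCommute M N') : EntriesCommute M (N * N') := by
  intro a b c d
  rw [Matrix.mul_apply]
  exact Commute.sum_right _ _ _ fun k _ => (h a b c k).mul_right (h' a b k d)

theorem EntriesCommute.lax_right {M P : Matrix (Fin 2) (Fin 2) A} (h : EntriesCommute M P)
    (η u : ℂ) : EntriesCommute M (lax η P u) := by
  intro a b c d
  simp only [lax, Matrix.add_apply, Matrix.smul_apply, Matrix.one_apply]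
  refine Commute.add_right (Commute.smul_right ?_ _) (Commute.smul_right (h a b c d) _)
  split_ifs
  exacts [Commute.one_right _, Commute.zero_right _]

theorem EntriesCommute.neg_right {M N : Matrix (Fin 2) (Fin 2) A} (h : EntriesCommute M N) :
    EntriesCommute M (-N) := fun a b c d => (h a b c d).neg_right

/-- Like the adjugate of a number matrix, `adj` reverses products, but only when entries of
different factors commute. -/
theorem adj_mul {M N : Matrix (Fin 2) (Fin 2) A} (h : EntriesCommute M N) :
    adj (M * N) = adj N * adj M := by
  ext i j
  fin_cases i <;> fin_cases j <;>
    simp [adj, Matrix.mul_apply, Fin.sum_univ_two, (h _ _ _ _).eq, add_comm]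

theorem adj_eq (M : Matrix (Fin 2) (Fin 2) A) : adj M = Matrix.scalar (Fin 2) M.trace - M := by
  ext i j
  fin_cases i <;> fin_cases j <;> simp [adj, Matrix.trace, Fin.sum_univ_two]

namespace IsPerm

variable {P U : Matrix (Fin 2) (Fin 2) A}

theorem sq (hP : IsPerm P) : P * P = 1 := by
  ext i j
  have := hP.one
  fin_cases i <;> fin_cases j <;>
    simp [Matrix.mul_apply, hP.mul, Fin.sum_univ_two, this]

/-- Conjugation by `P` carries `U` from the auxiliary space to the site, so what remains is trivial
in the auxiliary space. -/
theorem conj (hP : IsPerm P) (h : EntriesCommute P U) :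
    P * U * P = Matrix.scalar (Fin 2) (hat P U) := by
  have key : ∀ a b c d k l, P a b * U k l * P c d = if a = d then U k l * P c b else 0 := by
    intro a b c d k l
    rw [(h a b k l).eq, mul_assoc, hP.mul]; split_ifs <;> simp
  ext i j
  fin_cases i <;> fin_cases j <;>
    simp [Matrix.mul_apply, Fin.sum_univ_two, add_mul, key, hat] <;> abel

/-- The left side is (1 - P) U (1 - P). Since 1 - P is twice the rank-one projection onto the
singlet of auxiliary space and site, the sandwich only sees the trace of `U`. -/
theorem singlet (hP : IsPerm P) (h : EntriesCommute P U) :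
    U - U * P - P * U + P * U * P = Matrix.scalar (Fin 2) U.trace * (1 - P) := by
  rw [hP.conj h]
  have h1 : P 1 1 = 1 - P 0 0 := by rw [← hP.one]; abel
  ext i j
  fin_cases i <;> fin_cases j <;>
    simp [Matrix.mul_apply, Fin.sum_univ_two, hat, Matrix.trace, (h _ _ _ _).eq, h1] <;>
    noncomm_ring

end IsPerm

/-- Adding a site with permutation `P` and inhomogeneity `s`. -/
def addSite (η : ℂ) (P : Matrix (Fin 2) (Fin 2) A) (s z : ℂ) (U : Matrix (Fin 2) (Fin 2) A) :
    Matrix (Fin 2) (Fin 2) A :=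
  lax η P (z - η / 2 - s) * U * -lax η P (z - η / 2 + s)

theorem addSite_eq {P U : Matrix (Fin 2) (Fin 2) A} (hP : IsPerm P) (h : EntriesCommute P U)
    (η s z : ℂ) :
    addSite η P s z U = -(((z - η / 2 - s) * (z - η / 2 + s)) • U
      + ((z - η / 2 - s) * η) • (U * P) + ((z - η / 2 + s) * η) • (P * U)
      + (η * η) • Matrix.scalar (Fin 2) (hat P U)) := by
  rw [← hP.conj h]
  simp only [addSite, lax, add_mul, mul_add, smul_mul_assoc, mul_smul_comm, one_mul,
    mul_one, mul_neg, neg_add]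
  module

theorem trace_mul_perm {P U : Matrix (Fin 2) (Fin 2) A} : (U * P).trace = hat P U := by
  simp [Matrix.trace, Matrix.mul_apply, hat]

theorem trace_perm_mul {P U : Matrix (Fin 2) (Fin 2) A} (h : EntriesCommute P U) :
    (P * U).trace = hat P U := by
  simp [Matrix.trace, Matrix.mul_apply, hat, Fin.sum_univ_two, (h _ _ _ _).eq]; abel

theorem trace_addSite {P U : Matrix (Fin 2) (Fin 2) A} (hP : IsPerm P) (h : EntriesCommute P U)
    (η s z : ℂ) :
    (addSite η P s z U).trace = -(((z - η / 2 - s) * (z - η / 2 + s)) • U.trace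
      + (η * (2 * z + η)) • hat P U) := by
  rw [addSite_eq hP h]
  simp only [Matrix.trace_neg, Matrix.trace_add, Matrix.trace_smul, trace_mul_perm,
    trace_perm_mul h]
  have : (Matrix.scalar (Fin 2) (hat P U)).trace = (2 : ℂ) • hat P U := by
    simp [Matrix.trace, two_smul]
  rw [this]
  module

theorem commute_scalar_trace {P U : Matrix (Fin 2) (Fin 2) A} (h : EntriesCommute P U) :
    Commute P (Matrix.scalar (Fin 2) U.trace) := by
  ext i j
  simp [Matrix.trace, mul_add, add_mul, (h _ _ _ _).eq]

/-- The symmetry `z ↦ -z`. -/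
structure Parity (η : ℂ) (U : ℂ → Matrix (Fin 2) (Fin 2) A) : Prop where
  trace_neg : ∀ z, (U (-z)).trace = (U z).trace
  add_neg : ∀ z, (2 * z + η) • U z + (2 * z - η) • U (-z)
    = (2 * z) • Matrix.scalar (Fin 2) (U z).trace

theorem hat_add_smul {P U V : Matrix (Fin 2) (Fin 2) A} (a b : ℂ) :
    hat P (a • U + b • V) = a • hat P U + b • hat P V := by
  simp [hat, add_mul, Finset.sum_add_distrib]

theorem hat_scalar {P : Matrix (Fin 2) (Fin 2) A} (hP : IsPerm P) (t : A) :
    hat P (Matrix.scalar (Fin 2) t) = t := by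
  simp [hat, Fin.sum_univ_two, ← mul_add, hP.one]

theorem hat_smul {P U : Matrix (Fin 2) (Fin 2) A} (a : ℂ) :
    hat P (a • U) = a • hat P U := by
  simp [hat]

theorem scalar_smul (a : ℂ) (t : A) :
    Matrix.scalar (Fin 2) (a • t) = a • Matrix.scalar (Fin 2) t := by
  ext i j
  fin_cases i <;> fin_cases j <;> simp

/-- Dressing mixes `U`, `U * P`, `P * U` and `hat P U`. Parity of `U` controls each of these
separately, and the leftover trace terms are exactly those of the singlet identity. -/
theorem Parity.addSite {η : ℂ} {U : ℂ → Matrix (Fin 2) (Fin 2) A} (hU : Parity η U)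
    {P : Matrix (Fin 2) (Fin 2) A} (hP : IsPerm P) (h : ∀ z, EntriesCommute P (U z)) (s : ℂ) :
    Parity η fun z => addSite η P s z (U z) := by
  have hhat : ∀ z, (2 * z + η) • hat P (U z) + (2 * z - η) • hat P (U (-z))
      = (2 * z) • (U z).trace := by
    intro z
    rw [← hat_add_smul, hU.add_neg, hat_smul, hat_scalar hP]
  constructor
  · intro z
    rw [trace_addSite hP (h _), trace_addSite hP (h _), hU.trace_neg]
    linear_combination (norm := module) η • hhat z
  · intro z
    rw [trace_addSite hP (h _), addSite_eq hP (h _), addSite_eq hP (h _)]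
    have hs := hP.singlet (h z)
    rw [hP.conj (h z)] at hs
    have e := hU.add_neg z
    have eP : (2 * z + η) • (U z * P) + (2 * z - η) • (U (-z) * P)
        = (2 * z) • (Matrix.scalar (Fin 2) (U z).trace * P) := by
      rw [← smul_mul_assoc, ← smul_mul_assoc, ← add_mul, e, smul_mul_assoc]
    have Pe : (2 * z + η) • (P * U z) + (2 * z - η) • (P * U (-z))
        = (2 * z) • (Matrix.scalar (Fin 2) (U z).trace * P) := by
      rw [← mul_smul_comm, ← mul_smul_comm, ← mul_add, e, mul_smul_comm]
      rw [(commute_scalar_trace (h z)).eq]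
    have he := congrArg (Matrix.scalar (Fin 2)) (hhat z)
    simp only [map_add, map_neg, scalar_smul] at he ⊢
    rw [mul_sub, mul_one] at hs
    linear_combination (norm := module) (η * (2 * z) * (2 * z + η)) • hs
      - ((z - η / 2 - s + η) * (z - η / 2 + s + η)) • e + ((z - η / 2 + s + η) * η) • eP
      + ((z - η / 2 - s + η) * η) • Pe - (η * η) • he


/-- A matrix of numbers in auxiliary space. -/
def num : Matrix (Fin 2) (Fin 2) ℂ →+* Matrix (Fin 2) (Fin 2) A := (algebraMap ℂ A).mapMatrix

theorem num_apply (m : Matrix (Fin 2) (Fin 2) ℂ) (a b : Fin 2) :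
    (num m : Matrix (Fin 2) (Fin 2) A) a b = algebraMap ℂ A (m a b) := rfl

theorem num_smul (a : ℂ) (m : Matrix (Fin 2) (Fin 2) ℂ) :
    (num (a • m) : Matrix (Fin 2) (Fin 2) A) = a • num m := by
  ext i j
  rw [num_apply, Matrix.smul_apply, Matrix.smul_apply, num_apply, smul_eq_mul, map_mul,
    Algebra.smul_def]

theorem entriesCommute_num (M : Matrix (Fin 2) (Fin 2) A) (m : Matrix (Fin 2) (Fin 2) ℂ) :
    EntriesCommute M (num m) := fun _ _ _ _ => (Algebra.commutes _ _).symm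

theorem trace_num_mul (m : Matrix (Fin 2) (Fin 2) ℂ) (M : Matrix (Fin 2) (Fin 2) A) :
    (num m * M).trace = (M * num m).trace := by
  simp only [Matrix.trace, Matrix.diag_apply, Matrix.mul_apply, num_apply]
  rw [Finset.sum_comm]
  exact Finset.sum_congr rfl fun i _ => Finset.sum_congr rfl fun j _ => Algebra.commutes _ _

theorem num_mul_scalar (m : Matrix (Fin 2) (Fin 2) ℂ) (t : A) :
    num m * Matrix.scalar (Fin 2) t = Matrix.scalar (Fin 2) t * num m := by
  ext i j
  simp [num_apply, Algebra.commutes]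

theorem Parity.conj {η : ℂ} {U : ℂ → Matrix (Fin 2) (Fin 2) A} (hU : Parity η U)
    {g g' : Matrix (Fin 2) (Fin 2) ℂ} (hg : g * g' = 1) :
    Parity η fun z => num g * U z * num g' := by
  have hg' : g' * g = 1 := mul_eq_one_comm.mp hg
  have ht : ∀ z, (num g * U z * num g').trace = (U z).trace := by
    intro z
    rw [← trace_num_mul, ← mul_assoc, ← map_mul, hg', map_one, one_mul]
  constructor
  · intro z
    simp only [ht, hU.trace_neg]
  · intro z
    rw [ht, ← smul_mul_assoc, ← mul_smul_comm, ← smul_mul_assoc, ← mul_smul_comm, ← add_mul,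
      ← mul_add, hU.add_neg, mul_smul_comm, num_mul_scalar, smul_mul_assoc, mul_assoc, ← map_mul,
      hg, map_one, mul_one]

/-- The boundary matrix `1 + (z - η/2) N`. -/
def boundary (η : ℂ) (N : Matrix (Fin 2) (Fin 2) ℂ) (z : ℂ) : Matrix (Fin 2) (Fin 2) A :=
  1 + (z - η / 2) • num N

theorem parity_boundary (η : ℂ) {N : Matrix (Fin 2) (Fin 2) ℂ} (hN : N.trace = 0) :
    Parity η (boundary η N : ℂ → Matrix (Fin 2) (Fin 2) A) := by
  have h0 : (num N : Matrix (Fin 2) (Fin 2) A).trace = 0 := by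
    simp only [Matrix.trace, Matrix.diag_apply, num_apply, ← map_sum] at hN ⊢
    rw [hN, map_zero]
  have ht : ∀ z, (boundary η N z : Matrix (Fin 2) (Fin 2) A).trace = (2 : ℂ) • 1 := by
    intro z
    simp [boundary, h0, two_smul, one_add_one_eq_two]
  refine ⟨fun z => by rw [ht, ht], fun z => ?_⟩
  rw [ht, scalar_smul, map_one, boundary, boundary]
  module

/-- `U(z + η/2) U(η/2 - z)` is the number `f z`. -/
def Unitary (η : ℂ) (f : ℂ → ℂ) (U : ℂ → Matrix (Fin 2) (Fin 2) A) : Prop :=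
  ∀ z, U (z + η / 2) * U (η / 2 - z) = f z • 1

theorem unitary_boundary (η : ℂ) {N : Matrix (Fin 2) (Fin 2) ℂ} {ν : ℂ} (hN : N * N = ν • 1) :
    Unitary η (fun z => 1 - z ^ 2 * ν) (boundary η N : ℂ → Matrix (Fin 2) (Fin 2) A) := by
  intro z
  have h : (num N * num N : Matrix (Fin 2) (Fin 2) A) = ν • 1 := by
    rw [← map_mul, hN, num_smul, map_one]
  simp only [boundary, mul_add, add_mul, one_mul, mul_one, smul_mul_assoc, mul_smul_comm, h]
  module

theorem lax_mul_lax_neg (η u : ℂ) {P : Matrix (Fin 2) (Fin 2) A} (hP : IsPerm P) :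
    lax η P u * lax η P (-u) = (η ^ 2 - u ^ 2) • 1 := by
  simp only [lax, mul_add, add_mul, one_mul, mul_one, smul_mul_assoc, mul_smul_comm, hP.sq]
  module

/-- At z + η/2 and η/2 - z the Lax arguments are opposite in pairs, so the product telescopes from
the middle outwards through L(u) L(-u) = η² - u². -/
theorem Unitary.addSite {η : ℂ} {f : ℂ → ℂ} {U : ℂ → Matrix (Fin 2) (Fin 2) A}
    (hU : Unitary η f U) {P : Matrix (Fin 2) (Fin 2) A} (hP : IsPerm P) (s : ℂ) :
    Unitary η (fun z => ((z - s) ^ 2 - η ^ 2) * ((z + s) ^ 2 - η ^ 2) * f z)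
      fun z => addSite η P s z (U z) := by
  intro z
  have h1 := lax_mul_lax_neg η (z + s) hP
  have h2 := lax_mul_lax_neg η (z - s) hP
  have e1 : z + η / 2 - η / 2 - s = z - s := by ring
  have e2 : z + η / 2 - η / 2 + s = z + s := by ring
  have e3 : η / 2 - z - η / 2 - s = -(z + s) := by ring
  have e4 : η / 2 - z - η / 2 + s = -(z - s) := by ring
  simp only [OpenXXX.addSite, e1, e2, e3, e4]
  calc lax η P (z - s) * U (z + η / 2) * -lax η P (z + s) *
        (lax η P (-(z + s)) * U (η / 2 - z) * -lax η P (-(z - s)))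
      = lax η P (z - s) * (U (z + η / 2) * (lax η P (z + s) * lax η P (-(z + s))) *
        U (η / 2 - z)) * lax η P (-(z - s)) := by noncomm_ring
    _ = _ := by
      rw [h1, mul_smul_comm, mul_one, smul_mul_assoc, hU z, mul_smul_comm, mul_smul_comm, mul_one,
        smul_mul_assoc, smul_mul_assoc, h2]
      module

theorem Unitary.conj {η : ℂ} {f : ℂ → ℂ} {U : ℂ → Matrix (Fin 2) (Fin 2) A}
    (hU : Unitary η f U) {g g' : Matrix (Fin 2) (Fin 2) ℂ} (hg : g * g' = 1) :
    Unitary η f fun z => num g * U z * num g' := by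
  intro z
  have hg' : (num g' * num g : Matrix (Fin 2) (Fin 2) A) = 1 := by
    rw [← map_mul, mul_eq_one_comm.mp hg, map_one]
  have hg2 : (num g * num g' : Matrix (Fin 2) (Fin 2) A) = 1 := by
    rw [← map_mul, hg, map_one]
  calc num g * U (z + η / 2) * num g' * (num g * U (η / 2 - z) * num g')
      = num g * (U (z + η / 2) * (num g' * num g) * U (η / 2 - z)) * num g' := by noncomm_ring
    _ = _ := by rw [hg', mul_one, hU z, mul_smul_comm, mul_one, smul_mul_assoc, hg2]

end Abstract

/-! ### The Yang–Baxter and reflection equations -/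

section Reflection

variable {A : Type*} [Ring A] [Algebra ℂ A]

/-- Matrices in the tensor square of the auxiliary space. -/
abbrev Aux2 (A : Type*) : Type _ := Matrix (Fin 2) (Fin 2) (Matrix (Fin 2) (Fin 2) A)

/-- A matrix acting in the first auxiliary space. -/
def aux1 : Matrix (Fin 2) (Fin 2) A →+* Aux2 A := (Matrix.scalar (Fin 2)).mapMatrix

/-- A matrix acting in the second auxiliary space. -/
def aux2 : Matrix (Fin 2) (Fin 2) A →+* Aux2 A := Matrix.scalar (Fin 2)

/-- The permutation of the two auxiliary spaces. -/
def swapAux : Aux2 A := fun i j => Matrix.single j i 1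

theorem aux1_apply (M : Matrix (Fin 2) (Fin 2) A) (i j k l : Fin 2) :
    aux1 M i j k l = if k = l then M i j else 0 := by
  simp [aux1, Matrix.diagonal_apply]

theorem aux2_apply (M : Matrix (Fin 2) (Fin 2) A) (i j k l : Fin 2) :
    aux2 M i j k l = if i = j then M k l else 0 := by
  simp only [aux2, Matrix.scalar_apply, Matrix.diagonal_apply]
  split_ifs <;> rfl

theorem aux1_smul (a : ℂ) (M : Matrix (Fin 2) (Fin 2) A) : aux1 (a • M) = a • aux1 M := by
  ext i j k l
  simp [aux1_apply]

theorem aux2_smul (a : ℂ) (M : Matrix (Fin 2) (Fin 2) A) : aux2 (a • M) = a • aux2 M := by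
  ext i j k l
  simp [aux2_apply]

theorem isPerm_swapAux : IsPerm (swapAux : Aux2 A) := by
  constructor
  · intro a b c d
    simp only [swapAux]
    split_ifs with h
    · subst h; simp
    · simp [h]
  · ext i j
    fin_cases i <;> fin_cases j <;> simp [swapAux]

theorem swapAux_mul_aux1 (M : Matrix (Fin 2) (Fin 2) A) : swapAux * aux1 M = aux2 M * swapAux := by
  ext i j k l
  fin_cases i <;> fin_cases j <;> fin_cases k <;> fin_cases l <;>
    simp [Matrix.mul_apply, Fin.sum_univ_two, aux1_apply, aux2_apply, swapAux, Matrix.single_apply]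

theorem swapAux_mul_aux2 (M : Matrix (Fin 2) (Fin 2) A) : swapAux * aux2 M = aux1 M * swapAux := by
  ext i j k l
  fin_cases i <;> fin_cases j <;> fin_cases k <;> fin_cases l <;>
    simp [Matrix.mul_apply, Fin.sum_univ_two, aux1_apply, aux2_apply, swapAux, Matrix.single_apply]

theorem aux1_mul_aux2 {M N : Matrix (Fin 2) (Fin 2) A} (h : EntriesCommute M N) :
    aux1 M * aux2 N = aux2 N * aux1 M := by
  ext i j k l
  fin_cases i <;> fin_cases j <;> fin_cases k <;> fin_cases l <;>
    simp [Matrix.mul_apply, Fin.sum_univ_two, aux1_apply, aux2_apply, (h _ _ _ _).eq]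

/-- The reflection equation. -/
def Reflection (η : ℂ) (U : ℂ → Matrix (Fin 2) (Fin 2) A) : Prop :=
  ∀ z w, lax η swapAux (z - w) * aux1 (U z) * lax η swapAux (z + w - η) * aux2 (U w)
    = aux2 (U w) * lax η swapAux (z + w - η) * aux1 (U z) * lax η swapAux (z - w)

theorem IsPerm.aux1_mul_aux2 {P : Matrix (Fin 2) (Fin 2) A} (hP : IsPerm P) :
    aux1 P * aux2 P = swapAux * aux1 P := by
  ext i j k l
  fin_cases i <;> fin_cases j <;> fin_cases k <;> fin_cases l <;>
    simp [Matrix.mul_apply, Fin.sum_univ_two, aux1_apply, aux2_apply, swapAux, Matrix.single_apply,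
      hP.mul]

theorem IsPerm.aux2_mul_aux1 {P : Matrix (Fin 2) (Fin 2) A} (hP : IsPerm P) :
    aux2 P * aux1 P = swapAux * aux2 P := by
  ext i j k l
  fin_cases i <;> fin_cases j <;> fin_cases k <;> fin_cases l <;>
    simp [Matrix.mul_apply, Fin.sum_univ_two, aux1_apply, aux2_apply, swapAux, Matrix.single_apply,
      hP.mul]

theorem aux1_lax (η u : ℂ) (P : Matrix (Fin 2) (Fin 2) A) :
    aux1 (lax η P u) = lax η (aux1 P) u := by
  simp only [lax, map_add, aux1_smul, map_one]

theorem aux2_lax (η u : ℂ) (P : Matrix (Fin 2) (Fin 2) A) :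
    aux2 (lax η P u) = lax η (aux2 P) u := by
  simp only [lax, map_add, aux2_smul, map_one]

/-- The Yang–Baxter equation. -/
theorem IsPerm.yangBaxter {P : Matrix (Fin 2) (Fin 2) A} (hP : IsPerm P) (η : ℂ) {u v w : ℂ}
    (h : w = u - v) :
    lax η swapAux w * aux1 (lax η P u) * aux2 (lax η P v)
      = aux2 (lax η P v) * aux1 (lax η P u) * lax η swapAux w := by
  have h1 := hP.aux1_mul_aux2
  have h2 := hP.aux2_mul_aux1
  have h3 := swapAux_mul_aux1 P
  have h4 := swapAux_mul_aux2 P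
  have h5 : swapAux * (swapAux * aux1 P) = aux1 P := by
    rw [← mul_assoc, isPerm_swapAux.sq, one_mul]
  have h6 : swapAux * aux2 P * swapAux = aux1 P := by
    rw [h4, mul_assoc, isPerm_swapAux.sq, mul_one]
  rw [aux1_lax, aux2_lax]
  simp only [lax, mul_add, add_mul, one_mul, mul_one, smul_mul_assoc, mul_smul_comm, h2, h6]
  simp only [mul_assoc, h1, h5, ← h3, ← h4, h]
  module

/-- This is the previous equation with one Lax matrix carried across; as the inverse of L(v) is
proportional to L(-v), the difference of arguments becomes a sum. It serves the middle factor of the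
reflection equation. -/
theorem IsPerm.yangBaxter' {P : Matrix (Fin 2) (Fin 2) A} (hP : IsPerm P) (η : ℂ) {u v w : ℂ}
    (h : w = u + v) :
    aux1 (lax η P u) * lax η swapAux w * aux2 (lax η P v)
      = aux2 (lax η P v) * lax η swapAux w * aux1 (lax η P u) := by
  have h1 := hP.aux1_mul_aux2
  have h2 := hP.aux2_mul_aux1
  have h3 := swapAux_mul_aux1 P
  have h4 := swapAux_mul_aux2 P
  have h5 : aux1 P * aux1 P = 1 := by rw [← map_mul, hP.sq, map_one]
  have h6 : aux2 P * aux2 P = 1 := by rw [← map_mul, hP.sq, map_one]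
  rw [aux1_lax, aux2_lax]
  simp only [lax, mul_add, add_mul, one_mul, mul_one, smul_mul_assoc, mul_smul_comm]
  simp only [mul_assoc, h1, h2, h5, h6, ← h3, ← h4, h, mul_one]
  module

/-- The reordering common to dressing by a site and conjugation by a number matrix: `a`, `a'`
surround `x` in the first auxiliary space, `b`, `b'` surround `y` in the second, and `R`, `R'` are
the two R-matrices. -/
theorem reflection_step {B : Type*} [Ring B] {R R' a a' b b' x y : B}
    (y1 : R * a * b = b * a * R) (y2 : R * a' * b' = b' * a' * R)
    (y3 : a' * R' * b = b * R' * a') (y4 : a * R' * b' = b' * R' * a)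
    (c1 : x * b = b * x) (c1' : x * b' = b' * x) (c2 : a * y = y * a) (c2' : a' * y = y * a')
    (r : R * x * R' * y = y * R' * x * R) :
    R * (a * x * a') * R' * (b * y * b') = b * y * b' * R' * (a * x * a') * R :=
  calc R * (a * x * a') * R' * (b * y * b')
      = R * a * x * (a' * R' * b) * y * b' := by simp only [mul_assoc]
    _ = R * a * (x * b) * R' * (a' * y) * b' := by rw [y3]; simp only [mul_assoc]
    _ = (R * a * b) * x * R' * y * a' * b' := by rw [c1, c2']; simp only [mul_assoc]
    _ = b * a * (R * x * R' * y) * a' * b' := by rw [y1]; simp only [mul_assoc]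
    _ = b * (a * y) * R' * x * (R * a' * b') := by rw [r]; simp only [mul_assoc]
    _ = b * y * a * R' * (x * b') * a' * R := by rw [c2, y2]; simp only [mul_assoc]
    _ = b * y * (a * R' * b') * x * a' * R := by rw [c1']; simp only [mul_assoc]
    _ = _ := by rw [y4]; simp only [mul_assoc]

theorem Reflection.addSite {η : ℂ} {U : ℂ → Matrix (Fin 2) (Fin 2) A} (hU : Reflection η U)
    {P : Matrix (Fin 2) (Fin 2) A} (hP : IsPerm P) (h : ∀ z, EntriesCommute P (U z)) (s : ℂ) :
    Reflection η fun z => addSite η P s z (U z) := by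
  intro z w
  simp only [OpenXXX.addSite, map_mul]
  have c1 : ∀ u v, aux2 (lax η P u) * aux1 (U v) = aux1 (U v) * aux2 (lax η P u) := fun u v =>
    (OpenXXX.aux1_mul_aux2 ((h v).symm.lax_right η u)).symm
  have c2 : ∀ u v, aux1 (lax η P u) * aux2 (U v) = aux2 (U v) * aux1 (lax η P u) := fun u v =>
    OpenXXX.aux1_mul_aux2 ((h v).symm.lax_right η u).symm
  refine reflection_step (hP.yangBaxter η (by ring)) ?_ ?_ ?_ (c1 _ _).symm ?_ (c2 _ _) ?_ (hU z w)
  · simpa using hP.yangBaxter η (u := z - η / 2 + s) (v := w - η / 2 + s) (w := z - w) (by ring)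
  · simpa using hP.yangBaxter' η (u := z - η / 2 + s) (v := w - η / 2 - s) (w := z + w - η)
      (by ring)
  · simpa using hP.yangBaxter' η (u := z - η / 2 - s) (v := w - η / 2 + s) (w := z + w - η)
      (by ring)
  · simpa using (c1 _ _).symm
  · simpa using c2 _ _

theorem reflection_boundary (η : ℂ) {N : Matrix (Fin 2) (Fin 2) ℂ} {ν : ℂ} (hN : N * N = ν • 1) :
    Reflection η (boundary η N : ℂ → Matrix (Fin 2) (Fin 2) A) := by
  intro z w
  have h1 : (aux1 (num N) * aux1 (num N) : Aux2 A) = ν • 1 := by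
    rw [← map_mul, ← map_mul, hN, num_smul, aux1_smul, map_one, map_one]
  have h2 : (aux2 (num N) * aux2 (num N) : Aux2 A) = ν • 1 := by
    rw [← map_mul, ← map_mul, hN, num_smul, aux2_smul, map_one, map_one]
  have h3 := swapAux_mul_aux1 (num N : Matrix (Fin 2) (Fin 2) A)
  have h4 := swapAux_mul_aux2 (num N : Matrix (Fin 2) (Fin 2) A)
  have h5 := aux1_mul_aux2 (entriesCommute_num (num N : Matrix (Fin 2) (Fin 2) A) N)
  have hs := (isPerm_swapAux (A := A)).sq
  simp only [boundary, map_add, map_one, aux1_smul, aux2_smul]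
  generalize (aux1 (num N) : Aux2 A) = x at *
  generalize (aux2 (num N) : Aux2 A) = y at *
  generalize (swapAux : Aux2 A) = p at *
  have h3' : ∀ c, y * (p * c) = p * (x * c) := fun c => by rw [← mul_assoc, ← h3, mul_assoc]
  have hs' : ∀ c, p * (p * c) = c := fun c => by rw [← mul_assoc, hs, one_mul]
  simp only [lax, mul_add, add_mul, one_mul, mul_one, smul_mul_assoc, mul_smul_comm]
  simp only [mul_assoc, h1, h2, h3', hs', hs, ← h3, ← h4, h5, mul_one, mul_smul_comm,
    smul_mul_assoc, one_mul]
  module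

theorem Reflection.conj {η : ℂ} {U : ℂ → Matrix (Fin 2) (Fin 2) A} (hU : Reflection η U)
    {g g' : Matrix (Fin 2) (Fin 2) ℂ} (hg : g * g' = 1) :
    Reflection η fun z => num g * U z * num g' := by
  intro z w
  have R1 : ∀ (h : Matrix (Fin 2) (Fin 2) ℂ) (u : ℂ),
      lax η swapAux u * aux1 (num h) * aux2 (num h)
        = aux2 (num h) * aux1 (num h) * lax η (swapAux : Aux2 A) u := by
    intro h u
    have e := aux1_mul_aux2 (entriesCommute_num (num h : Matrix (Fin 2) (Fin 2) A) h)
    simp only [lax, mul_add, add_mul, one_mul, mul_one, smul_mul_assoc, mul_smul_comm, e]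
    rw [mul_assoc (aux2 _), ← swapAux_mul_aux2, ← mul_assoc, ← swapAux_mul_aux1]
  have R2 : ∀ (h h' : Matrix (Fin 2) (Fin 2) ℂ) (u : ℂ), h * h' = 1 →
      aux1 (num h) * lax η swapAux u * aux2 (num h')
        = aux2 (num h') * lax η (swapAux : Aux2 A) u * aux1 (num h) := by
    intro h h' u hh
    have e := aux1_mul_aux2 (entriesCommute_num (num h : Matrix (Fin 2) (Fin 2) A) h')
    have e1 : (aux1 (num h) * aux1 (num h') : Aux2 A) = 1 := by
      rw [← map_mul, ← map_mul, hh, map_one, map_one]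
    have e2 : (aux2 (num h') * aux2 (num h) : Aux2 A) = 1 := by
      rw [← map_mul, ← map_mul, mul_eq_one_comm.mp hh, map_one, map_one]
    simp only [lax, mul_add, add_mul, mul_one, smul_mul_assoc, mul_smul_comm, e]
    rw [mul_assoc (aux1 _), swapAux_mul_aux2, ← mul_assoc, e1, mul_assoc (aux2 _),
      swapAux_mul_aux1, ← mul_assoc, e2]
  simp only [map_mul]
  exact reflection_step (R1 g _) (R1 g' _) (R2 g' g _ (mul_eq_one_comm.mp hg)) (R2 g g' _ hg)
    (aux1_mul_aux2 (entriesCommute_num _ _)) (aux1_mul_aux2 (entriesCommute_num _ _))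
    (aux1_mul_aux2 (entriesCommute_num _ _).symm) (aux1_mul_aux2 (entriesCommute_num _ _).symm)
    (hU z w)

/-- Exchange of two entries `𝒜`. -/
theorem Reflection.apply_AA {η : ℂ} {U : ℂ → Matrix (Fin 2) (Fin 2) A} (hU : Reflection η U)
    (z w : ℂ) :
    ((z - w + η) * (z + w)) • (U z 0 0 * U w 0 0 - U w 0 0 * U z 0 0)
      = ((z - w + η) * η) • (U w 0 1 * U z 1 0 - U z 0 1 * U w 1 0) := by
  -- The diagonal component of the reflection equation in which both auxiliary spaces stay in state
  -- 0.
  have h := congrFun (congrFun (congrFun (congrFun (hU z w) 0) 0) 0) 0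
  simp [Matrix.mul_apply, Fin.sum_univ_two, aux1_apply, aux2_apply, lax, swapAux, mul_add,
    add_mul, Matrix.single_apply] at h
  linear_combination (norm := module) h

/-- Exchange of the entries `𝒜` and `ℬ`. -/
theorem Reflection.apply_BA {η : ℂ} {U : ℂ → Matrix (Fin 2) (Fin 2) A} (hU : Reflection η U)
    (z w : ℂ) :
    ((z + w - η) * (z - w + η)) • (U z 0 1 * U w 0 0)
      = ((z - w) * (z + w)) • (U w 0 0 * U z 0 1) + ((z - w) * η) • (U w 0 1 * U z 1 1)
        + ((z + w - η) * η) • (U w 0 1 * U z 0 0) := by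
  -- Only the first auxiliary space goes from 0 to 1. The unwanted terms then all carry `U w 0 1` on
  -- the left, where it annihilates the covectors used later.
  have h := congrFun (congrFun (congrFun (congrFun (hU z w) 0) 1) 0) 0
  simp [Matrix.mul_apply, Fin.sum_univ_two, aux1_apply, aux2_apply, lax, swapAux, mul_add,
    add_mul, Matrix.single_apply] at h
  linear_combination (norm := module) h

end Reflection

/-! ### Chains of sites -/

section Chain

variable {A : Type*} [Ring A] [Algebra ℂ A] {ι : Type*}

/-- Commuting copies of `ℂ²`. -/
structure Sites (P : ι → Matrix (Fin 2) (Fin 2) A) : Prop where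
  perm : ∀ i, IsPerm (P i)
  comm : ∀ i j, i ≠ j → EntriesCommute (P i) (P j)

/-- Dressing of `U` by the sites of a list, the head of the list being the outermost one. -/
def chain (η : ℂ) (P : ι → Matrix (Fin 2) (Fin 2) A) (s : ι → ℂ)
    (U : ℂ → Matrix (Fin 2) (Fin 2) A) : List ι → ℂ → Matrix (Fin 2) (Fin 2) A
  | [], z => U z
  | i :: l, z => addSite η (P i) (s i) z (chain η P s U l z)

/-- The periodic monodromy matrix of a list of sites. -/
def mono (η : ℂ) (P : ι → Matrix (Fin 2) (Fin 2) A) (s : ι → ℂ) (l : List ι) (u : ℂ) :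
    Matrix (Fin 2) (Fin 2) A :=
  (l.map fun i => lax η (P i) (u - s i)).prod

theorem EntriesCommute.addSite {M P U : Matrix (Fin 2) (Fin 2) A} (h : EntriesCommute M P)
    (hU : EntriesCommute M U) (η s z : ℂ) : EntriesCommute M (addSite η P s z U) :=
  ((h.lax_right _ _).mul_right hU).mul_right (h.lax_right _ _).neg_right

theorem EntriesCommute.chain {M : Matrix (Fin 2) (Fin 2) A} {P : ι → Matrix (Fin 2) (Fin 2) A}
    {U : ℂ → Matrix (Fin 2) (Fin 2) A} {l : List ι} (h : ∀ i ∈ l, EntriesCommute M (P i))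
    (hU : ∀ z, EntriesCommute M (U z)) (η : ℂ) (s : ι → ℂ) (z : ℂ) :
    EntriesCommute M (chain η P s U l z) := by
  induction l with
  | nil => exact hU z
  | cons i l ih =>
    exact (h i List.mem_cons_self).addSite (ih fun j hj => h j (List.mem_cons_of_mem _ hj)) _ _ _

theorem Sites.comm_chain {P : ι → Matrix (Fin 2) (Fin 2) A} (hP : Sites P)
    {U : ℂ → Matrix (Fin 2) (Fin 2) A} (hU : ∀ i z, EntriesCommute (P i) (U z)) {i : ι}
    {l : List ι} (hi : i ∉ l) (η : ℂ) (s : ι → ℂ) (z : ℂ) :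
    EntriesCommute (P i) (OpenXXX.chain η P s U l z) :=
  EntriesCommute.chain (fun j hj => hP.comm i j fun h => hi (h ▸ hj)) (hU i) η s z

theorem Sites.parity_chain {P : ι → Matrix (Fin 2) (Fin 2) A} (hP : Sites P) {η : ℂ} (s : ι → ℂ)
    {U : ℂ → Matrix (Fin 2) (Fin 2) A} (hU : ∀ i z, EntriesCommute (P i) (U z)) (hp : Parity η U)
    {l : List ι} (hl : l.Nodup) : Parity η (OpenXXX.chain η P s U l) := by
  induction l with
  | nil => exact hp
  | cons i l ih =>
    rw [List.nodup_cons] at hl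
    exact (ih hl.2).addSite (hP.perm i) (hP.comm_chain hU hl.1 η s) (s i)

theorem Sites.reflection_chain {P : ι → Matrix (Fin 2) (Fin 2) A} (hP : Sites P) {η : ℂ}
    (s : ι → ℂ) {U : ℂ → Matrix (Fin 2) (Fin 2) A} (hU : ∀ i z, EntriesCommute (P i) (U z))
    (hp : Reflection η U) {l : List ι} (hl : l.Nodup) :
    Reflection η (OpenXXX.chain η P s U l) := by
  induction l with
  | nil => exact hp
  | cons i l ih =>
    rw [List.nodup_cons] at hl
    exact (ih hl.2).addSite (hP.perm i) (hP.comm_chain hU hl.1 η s) (s i)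

/-- The factor of a site in the quantum determinant. -/
def siteDet (η s z : ℂ) : ℂ := ((z - s) ^ 2 - η ^ 2) * ((z + s) ^ 2 - η ^ 2)

theorem Sites.unitary_chain {P : ι → Matrix (Fin 2) (Fin 2) A} (hP : Sites P) {η : ℂ}
    (s : ι → ℂ) {U : ℂ → Matrix (Fin 2) (Fin 2) A} {f : ℂ → ℂ} (hp : Unitary η f U)
    (l : List ι) :
    Unitary η (fun z => (l.map fun i => siteDet η (s i) z).prod * f z)
      (OpenXXX.chain η P s U l) := by
  induction l with
  | nil => exact fun z => by simpa [chain] using hp z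
  | cons i l ih =>
    intro z
    simpa only [chain, siteDet, List.map_cons, List.prod_cons, mul_assoc] using
      ih.addSite (hP.perm i) (s i) z

/-- Crossing symmetry: `adj M` is tr M - M, and the trace of `P` over the auxiliary space is 1. -/
theorem adj_lax {P : Matrix (Fin 2) (Fin 2) A} (hP : IsPerm P) (η u : ℂ) :
    adj (lax η P u) = -lax η P (-u - η) := by
  have ht : (lax η P u).trace = (2 * u + η) • 1 := by
    have h1 : P.trace = 1 := by rw [Matrix.trace_fin_two, hP.one]
    rw [lax, Matrix.trace_add, Matrix.trace_smul, Matrix.trace_smul, h1, Matrix.trace_one,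
      Fintype.card_fin, Nat.cast_ofNat, ← one_add_one_eq_two]
    module
  rw [adj_eq, ht, scalar_smul, map_one, lax, lax]
  module

/-- Dressing site by site agrees with the Sklyanin form T K σʸTᵗσʸ, because `adj` reverses the
monodromy product and crossing turns each of its factors into the right-hand Lax matrix of
`addSite`. -/
theorem chain_eq {P : ι → Matrix (Fin 2) (Fin 2) A} (hP : Sites P) (η : ℂ) (s : ι → ℂ)
    (U : ℂ → Matrix (Fin 2) (Fin 2) A) {l : List ι} (hl : l.Nodup) (z : ℂ) :
    chain η P s U l z = mono η P s l (z - η / 2) * U z * adj (mono η P s l (-z - η / 2)) := by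
  induction l with
  | nil =>
    have : adj (1 : Matrix (Fin 2) (Fin 2) A) = 1 := by
      ext i j; fin_cases i <;> fin_cases j <;> simp [adj]
    simp [chain, mono, this]
  | cons i l ih =>
    rw [List.nodup_cons] at hl
    have hc : EntriesCommute (lax η (P i) (-z - η / 2 - s i))
        (l.map fun j => lax η (P j) (-z - η / 2 - s j)).prod := by
      have hl' := hl.1
      clear ih hl
      induction l with
      | nil =>
        intro a b c d
        rw [List.map_nil, List.prod_nil, Matrix.one_apply]
        split_ifs
        exacts [Commute.one_right _, Commute.zero_right _]
      | cons j l ih =>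
        rw [List.mem_cons, not_or] at hl'
        rw [List.map_cons, List.prod_cons]
        exact EntriesCommute.mul_right
          (((hP.comm i j hl'.1).lax_right η _).symm.lax_right η _).symm (ih hl'.2)
    have e : -(-z - η / 2 - s i) - η = z - η / 2 + s i := by ring
    rw [chain, ih hl.2, addSite]
    simp only [mono, List.map_cons, List.prod_cons]
    rw [adj_mul hc, adj_lax (hP.perm i), e]
    simp only [mul_assoc]

end Chain

/-! ### Moving sites to the other boundary, and the one-site inversion formula -/

section Dual

variable {A : Type*} [Ring A] [Algebra ℂ A] {ι : Type*}

open MulOpposite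

/-- The entrywise passage to the opposite algebra. -/
def opm (M : Matrix (Fin 2) (Fin 2) A) : Matrix (Fin 2) (Fin 2) Aᵐᵒᵖ := M.map op

/-- The entrywise passage from the opposite algebra. -/
def unopm (M : Matrix (Fin 2) (Fin 2) Aᵐᵒᵖ) : Matrix (Fin 2) (Fin 2) A := M.map unop

/-- The trace in auxiliary space, with the entries of `W` to the left of those of `Z`. -/
def pairing (W : Matrix (Fin 2) (Fin 2) Aᵐᵒᵖ) (Z : Matrix (Fin 2) (Fin 2) A) : A :=
  ∑ a, ∑ b, unop (W a b) * Z b a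

/-- The permutation of a site in the opposite algebra. -/
def dualPerm (P : Matrix (Fin 2) (Fin 2) A) : Matrix (Fin 2) (Fin 2) Aᵐᵒᵖ := 1 - opm P

/-- Reversing multiplication in the algebra spoils the index pattern of the matrix units; passing
from `P` to 1 - P, which is `adj P`, restores it. -/
theorem IsPerm.dual {P : Matrix (Fin 2) (Fin 2) A} (hP : IsPerm P) : IsPerm (dualPerm P) := by
  have h1 : P 1 1 = 1 - P 0 0 := by rw [← hP.one]; abel
  have h := hP.mul
  constructor
  · intro a b c d
    apply unop_injective
    fin_cases a <;> fin_cases b <;> fin_cases c <;> fin_cases d <;>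
      simp [dualPerm, opm, mul_sub, sub_mul, h] <;> simp [h1]
  · apply unop_injective
    simp [dualPerm, opm, h1]

theorem EntriesCommute.one_sub_right {M N : Matrix (Fin 2) (Fin 2) A} (h : EntriesCommute M N) :
    EntriesCommute M (1 - N) := by
  intro a b c d
  rw [Matrix.sub_apply, Matrix.one_apply]
  refine Commute.sub_right ?_ (h a b c d)
  split_ifs
  exacts [Commute.one_right _, Commute.zero_right _]

theorem EntriesCommute.opm {M N : Matrix (Fin 2) (Fin 2) A} (h : EntriesCommute M N) :
    EntriesCommute (opm M) (opm N) := fun a b c d => (h a b c d).op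

theorem Sites.dual {P : ι → Matrix (Fin 2) (Fin 2) A} (hP : Sites P) :
    Sites fun i => dualPerm (P i) :=
  ⟨fun i => (hP.perm i).dual,
    fun i j hij => (hP.comm i j hij).opm.one_sub_right.symm.one_sub_right.symm⟩

theorem opm_lax (η u : ℂ) (P : Matrix (Fin 2) (Fin 2) A) :
    opm (lax η P u) = -lax η (dualPerm P) (-u - η) := by
  ext a b
  fin_cases a <;> fin_cases b <;> apply unop_injective <;> simp [lax, dualPerm, opm] <;> module

/-- Cyclicity of the auxiliary trace for noncommuting entries. Working over the opposite algebra for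
`W` keeps the order of the quantum operators right when the outer factors pass to the other side. -/
theorem pairing_mul {W : Matrix (Fin 2) (Fin 2) Aᵐᵒᵖ} {M N Z : Matrix (Fin 2) (Fin 2) A}
    (hW : EntriesCommute (opm M) W) (hN : EntriesCommute N Z) :
    pairing W (M * Z * N) = pairing (opm N * W * opm M) Z := by
  have h1 : ∀ a b c d, unop (W a b) * M c d = M c d * unop (W a b) := fun a b c d =>
    congrArg unop (hW c d a b).eq
  have h2 : ∀ a b c d, Z a b * N c d = N c d * Z a b := fun a b c d => (hN c d a b).eq.symm
  have h1' : ∀ a b c d x, unop (W a b) * (M c d * x) = M c d * (unop (W a b) * x) :=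
    fun a b c d x => by rw [← mul_assoc, h1, mul_assoc]
  simp only [pairing, Matrix.mul_apply, Fin.sum_univ_two, opm, mul_add, add_mul, Matrix.map_apply,
    unop_add, unop_mul, unop_op, mul_assoc, h2, h1']
  abel

theorem pairing_addSite {W : Matrix (Fin 2) (Fin 2) Aᵐᵒᵖ} {P Z : Matrix (Fin 2) (Fin 2) A}
    (hW : EntriesCommute (opm P) W) (hP : EntriesCommute P Z) (η s z : ℂ) :
    pairing W (addSite η P s z Z) = pairing (addSite η (dualPerm P) s (-z) W) Z := by
  have e1 : -(z - η / 2 - s) - η = -z - η / 2 + s := by ring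
  have e2 : -(z - η / 2 + s) - η = -z - η / 2 - s := by ring
  have e3 : ∀ u, EntriesCommute (opm (lax η P u)) W := by
    intro u
    rw [opm_lax]
    exact (hW.symm.one_sub_right.lax_right _ _).neg_right.symm
  have e4 : ∀ M : Matrix (Fin 2) (Fin 2) A, opm (-M) = -opm M := fun M => by ext; simp [opm]
  rw [addSite, pairing_mul (e3 _) (hP.symm.lax_right _ _).neg_right.symm, e4, opm_lax, opm_lax,
    e1, e2, addSite, neg_neg]

/-- The outer sites of a chain can be absorbed into the boundary matrix of the other end. -/
theorem Sites.exists_dual {P : ι → Matrix (Fin 2) (Fin 2) A} (hP : Sites P) {η : ℂ} (s : ι → ℂ)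
    (l : List ι) (hl : l.Nodup) (W : ℂ → Matrix (Fin 2) (Fin 2) Aᵐᵒᵖ) (f : ℂ → ℂ)
    (hp : Parity η W) (hu : Unitary η f W) (hW : ∀ i ∈ l, ∀ z, EntriesCommute (opm (P i)) (W z)) :
    ∃ V : ℂ → Matrix (Fin 2) (Fin 2) Aᵐᵒᵖ, Parity η V ∧
      Unitary η (fun z => (l.map fun i => siteDet η (s i) z).prod * f z) V ∧
      (∀ Y : Matrix (Fin 2) (Fin 2) A, (∀ i ∈ l, EntriesCommute Y (P i)) →
        (∀ z, EntriesCommute (opm Y) (W z)) → ∀ z, EntriesCommute (opm Y) (V z)) ∧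
      ∀ Y : ℂ → Matrix (Fin 2) (Fin 2) A, (∀ i ∈ l, ∀ z, EntriesCommute (P i) (Y z)) →
        ∀ z, pairing (W (-z)) (OpenXXX.chain η P s Y l z) = pairing (V (-z)) (Y z) := by
  induction l generalizing W f with
  | nil => exact ⟨W, hp, fun z => by simpa using hu z, fun Y _ h => h, fun Y _ z => rfl⟩
  | cons i l ih =>
    rw [List.nodup_cons] at hl
    have hi : ∀ z, EntriesCommute (dualPerm (P i)) (W z) := fun z =>
      (hW i List.mem_cons_self z).symm.one_sub_right.symm
    obtain ⟨V, h1, h2, h3, h4⟩ := ih hl.2 _ _ (hp.addSite (hP.perm i).dual hi (s i))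
      (hu.addSite (hP.perm i).dual (s i)) (fun j hj z => by
        have hne : j ≠ i := fun h => hl.1 (h ▸ hj)
        exact EntriesCommute.addSite (hP.comm j i hne).opm.one_sub_right
          (hW j (List.mem_cons_of_mem _ hj) z) _ _ _)
    refine ⟨V, h1, ?_, fun Y hY hYW => h3 Y (fun j hj => hY j (List.mem_cons_of_mem _ hj))
      fun z => EntriesCommute.addSite (hY i List.mem_cons_self).opm.one_sub_right (hYW z) _ _ _, ?_⟩
    · intro z
      rw [h2 z]
      simp only [siteDet, List.map_cons, List.prod_cons]
      congr 1
      ring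
    · intro Y hY z
      rw [← h4 Y (fun j hj => hY j (List.mem_cons_of_mem _ hj))]
      refine pairing_addSite (hW i List.mem_cons_self _) ?_ _ _ _
      exact EntriesCommute.chain (fun j hj => hP.comm i j fun h => hl.1 (h ▸ hj))
        (hY i List.mem_cons_self) _ _ _

/-- On matrices whose entries commute with `P`, `hat P` transplants the auxiliary space onto the
site and is therefore multiplicative; only the second factor has to commute. -/
theorem hat_mul {P X Y : Matrix (Fin 2) (Fin 2) A} (hP : IsPerm P) (hY : EntriesCommute P Y) :
    hat P X * hat P Y = hat P (X * Y) := by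
  have h : ∀ x a b c d k l, x * P a b * (Y k l * P c d) = if a = d then x * Y k l * P c b else 0 := by
    intro x a b c d k l
    rw [mul_assoc, ← mul_assoc (P a b), (hY a b k l).eq, mul_assoc (Y k l), hP.mul]
    split_ifs <;> simp [mul_assoc]
  simp only [hat, Fin.sum_univ_two, mul_add, add_mul, h, Matrix.mul_apply]
  simp
  abel

theorem pairing_perm_mul {P Z : Matrix (Fin 2) (Fin 2) A} {W : Matrix (Fin 2) (Fin 2) Aᵐᵒᵖ}
    (hP : IsPerm P) (hZ : EntriesCommute P Z) (hW : EntriesCommute (opm P) W)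
    (hZW : EntriesCommute (opm Z) W) :
    pairing W (P * Z) = hat P Z * hat P (unopm W) := by
  rw [hat_mul hP]
  · have hh : ∀ a b c d, unop (W a b) * Z c d = Z c d * unop (W a b) := fun a b c d =>
      congrArg unop (hZW c d a b).eq
    simp only [pairing, hat, Matrix.mul_apply, Fin.sum_univ_two, unopm, Matrix.map_apply, mul_add,
      add_mul, (hZ _ _ _ _).eq]
    simp only [← mul_assoc, hh]
    abel
  · exact fun a b c d => (hW a b c d).unop

theorem pairing_mul_perm {P Z : Matrix (Fin 2) (Fin 2) A} {W : Matrix (Fin 2) (Fin 2) Aᵐᵒᵖ}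
    (hP : IsPerm P) (hZ : EntriesCommute P Z) :
    pairing W (Z * P) = hat P (unopm W) * hat P Z := by
  rw [hat_mul hP hZ]
  simp only [pairing, hat, Matrix.mul_apply, Fin.sum_univ_two, unopm, Matrix.map_apply, mul_add,
    add_mul, mul_assoc]
  abel

theorem pairing_scalar (W : Matrix (Fin 2) (Fin 2) Aᵐᵒᵖ) (x : A) :
    pairing W (Matrix.scalar (Fin 2) x) = unop W.trace * x := by
  simp [pairing, Fin.sum_univ_two, Matrix.trace, add_mul]

theorem pairing_smul (W : Matrix (Fin 2) (Fin 2) Aᵐᵒᵖ) (a : ℂ) (Z : Matrix (Fin 2) (Fin 2) A) :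
    pairing W (a • Z) = a • pairing W Z := by
  simp [pairing]

theorem pairing_add (W : Matrix (Fin 2) (Fin 2) Aᵐᵒᵖ) (Z Z' : Matrix (Fin 2) (Fin 2) A) :
    pairing W (Z + Z') = pairing W Z + pairing W Z' := by
  simp only [pairing, Fin.sum_univ_two, Matrix.add_apply, mul_add]
  abel

theorem pairing_neg (W : Matrix (Fin 2) (Fin 2) Aᵐᵒᵖ) (Z : Matrix (Fin 2) (Fin 2) A) :
    pairing W (-Z) = -pairing W Z := by
  simp only [pairing, Matrix.neg_apply, mul_neg, Finset.sum_neg_distrib]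

theorem unopm_adj_mul (M N : Matrix (Fin 2) (Fin 2) Aᵐᵒᵖ) :
    unopm (adj N) * unopm (adj M) = unopm (adj (M * N)) := by
  ext i j
  fin_cases i <;> fin_cases j <;>
    simp [unopm, adj, Matrix.mul_apply, Fin.sum_univ_two, add_comm]

theorem hat_unopm_adj {P : Matrix (Fin 2) (Fin 2) A} (hP : IsPerm P)
    (X : Matrix (Fin 2) (Fin 2) Aᵐᵒᵖ) :
    hat P (unopm (adj X)) = unop X.trace - hat P (unopm X) := by
  have h1 : P 1 1 = 1 - P 0 0 := by rw [← hP.one]; abel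
  simp [hat, unopm, adj, Fin.sum_univ_two, Matrix.trace, h1, mul_sub]
  abel

theorem Parity.hat_unopm {P : Matrix (Fin 2) (Fin 2) A} (hP : IsPerm P) {η : ℂ}
    {W : ℂ → Matrix (Fin 2) (Fin 2) Aᵐᵒᵖ} (hW : Parity η W) (z : ℂ) :
    (2 * z + η) • hat P (unopm (W z)) + (2 * z - η) • hat P (unopm (W (-z)))
      = (2 * z) • unop (W z).trace := by
  rw [← hat_add_smul]
  have h : (2 * z + η) • unopm (W z) + (2 * z - η) • unopm (W (-z))
      = (2 * z) • Matrix.scalar (Fin 2) (unop (W z).trace) := by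
    ext i j
    have := congrArg unop (congrFun (congrFun (hW.add_neg z) i) j)
    simpa [unopm, Matrix.diagonal_apply, apply_ite unop] using this
  rw [h, hat_smul, hat_scalar hP]

/-- The inversion formula for a one-site problem with operator-valued boundary matrices. -/
theorem pairing_addSite_mul {P : Matrix (Fin 2) (Fin 2) A} (hP : IsPerm P) {η s : ℂ}
    {W : ℂ → Matrix (Fin 2) (Fin 2) Aᵐᵒᵖ} {M : ℂ → Matrix (Fin 2) (Fin 2) A} {f g : ℂ → ℂ}
    (hWp : Parity η W) (hWu : Unitary η f W) (hMu : Unitary η g M)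
    (hM : ∀ z, EntriesCommute P (M z)) (hW : ∀ z, EntriesCommute (opm P) (W z))
    (hMW : ∀ z w, EntriesCommute (opm (M z)) (W w)) :
    pairing (W (-(s + η / 2))) (addSite η P s (s + η / 2) (M (s + η / 2)))
      * pairing (W (-(η / 2 - s))) (addSite η P s (η / 2 - s) (M (η / 2 - s)))
      = (4 * η ^ 2 * (η ^ 2 - s ^ 2) * f (-s) * g s) • 1 := by
  have htr : ∀ z w, Commute (unop (W z).trace) (hat P (M w)) := by
    intro z w
    have h : ∀ a, Commute (unop (W z a a)) (hat P (M w)) := fun a =>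
      Commute.sum_right _ _ _ fun b _ => Commute.sum_right _ _ _ fun c _ =>
        (hMW w z b c a a).unop.symm.mul_right (hW z c b a a).unop.symm
    rw [Matrix.trace_fin_two, unop_add]
    exact (h 0).add_left (h 1)
  -- At z = s + η/2 the left Lax matrix is ηP. Parity of `W` merges the two surviving terms into one
  -- product, with the factor of `M` on the left.
  have p1 : pairing (W (-(s + η / 2))) (addSite η P s (s + η / 2) (M (s + η / 2)))
      = (-(η * (2 * s + 2 * η))) • (hat P (M (s + η / 2)) * hat P (unopm (adj (W (s + η / 2))))) := by
    have h := hWp.hat_unopm hP (-(s + η / 2))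
    have e1 : s + η / 2 - η / 2 - s = 0 := by ring
    have e2 : s + η / 2 - η / 2 + s = 2 * s := by ring
    have ht := hWp.trace_neg (s + η / 2)
    have hc : unop (W (s + η / 2)).trace * hat P (M (s + η / 2))
        = hat P (M (s + η / 2)) * unop (W (s + η / 2)).trace :=
      (htr _ _).eq
    rw [addSite_eq hP (hM _), e1, e2, zero_mul, zero_mul, zero_smul, zero_smul, zero_add, zero_add,
      pairing_neg, pairing_add, pairing_smul, pairing_smul,
      pairing_perm_mul hP (hM _) (hW _) (hMW _ _), pairing_scalar, hat_unopm_adj hP, ht, hc]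
    rw [neg_neg, ht] at h
    have h' := congrArg (fun x => hat P (M (s + η / 2)) * x) h
    simp only [mul_add, mul_sub, mul_smul_comm] at h' ⊢
    linear_combination (norm := module) η • h'
  -- At z = η/2 - s the right Lax matrix degenerates instead, so the factor of `M` ends up on the
  -- right. In the product of the two values the factors of `W` therefore meet in the middle.
  have p2 : pairing (W (-(η / 2 - s))) (addSite η P s (η / 2 - s) (M (η / 2 - s)))
      = (η * (2 * s - 2 * η)) • (hat P (unopm (adj (W (η / 2 - s)))) * hat P (M (η / 2 - s))) := by
    have h := hWp.hat_unopm hP (-(η / 2 - s))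
    have e1 : η / 2 - s - η / 2 - s = -2 * s := by ring
    have e2 : η / 2 - s - η / 2 + s = 0 := by ring
    have ht := hWp.trace_neg (η / 2 - s)
    rw [addSite_eq hP (hM _), e1, e2, zero_mul, mul_zero, zero_smul, zero_smul, zero_add, add_zero,
      pairing_neg, pairing_add, pairing_smul, pairing_smul,
      pairing_mul_perm hP (hM _), pairing_scalar, hat_unopm_adj hP, ht]
    rw [neg_neg, ht] at h
    have h' := congrArg (fun x => x * hat P (M (η / 2 - s))) h
    simp only [add_mul, sub_mul, smul_mul_assoc] at h' ⊢
    linear_combination (norm := module) η • h'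
  have hadj : ∀ z, EntriesCommute P (unopm (adj (W z))) := by
    intro z a b c d
    have h := fun c d => (hW z a b c d).unop
    fin_cases c <;> fin_cases d
    exacts [h 1 1, (h 0 1).neg_right, (h 1 0).neg_right, h 0 0]
  -- The inversion relation of `W` at -s. Passing to `adj` and back from the opposite algebra
  -- reverses the order twice, so the factors appear here in the order needed.
  have q : hat P (unopm (adj (W (s + η / 2)))) * hat P (unopm (adj (W (η / 2 - s))))
      = f (-s) • 1 := by
    have hu := hWu (-s)
    have e1 : -s + η / 2 = η / 2 - s := by ring
    have e2 : η / 2 - -s = s + η / 2 := by ring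
    rw [e1, e2] at hu
    have h1 : unopm (adj (f (-s) • (1 : Matrix (Fin 2) (Fin 2) Aᵐᵒᵖ)))
        = f (-s) • Matrix.scalar (Fin 2) 1 := by
      ext i j
      fin_cases i <;> fin_cases j <;> simp [unopm, adj]
    rw [hat_mul hP (hadj _), unopm_adj_mul, hu, h1, hat_smul, hat_scalar hP]
  have r : hat P (M (s + η / 2)) * hat P (M (η / 2 - s)) = g s • 1 := by
    rw [hat_mul hP (hM _), hMu, hat_smul, ← map_one (Matrix.scalar (Fin 2)), hat_scalar hP]
  rw [p1, p2, smul_mul_smul_comm, mul_assoc, ← mul_assoc (hat P (unopm _)), q, smul_mul_assoc,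
    one_mul, mul_smul_comm, r]
  module

end Dual

/-! ### The spin-1/2 sites -/

theorem eq_update_iff {ι : Type*} [DecidableEq ι] {α : Type*} (j : ι) (a b : ι → α) (t : α) :
    b = Function.update a j t ↔ t = b j ∧ ∀ k, k ≠ j → a k = b k := by
  rw [Function.eq_update_iff]
  exact ⟨fun h => ⟨h.1.symm, fun k hk => (h.2 k hk).symm⟩,
    fun h => ⟨h.1.symm, fun k hk => (h.2 k hk).symm⟩⟩

theorem siteOp_mulVec (j : Fin L) (m : Matrix (Fin 2) (Fin 2) ℂ) (ψ : Space L)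
    (a : Fin L → Fin 2) :
    (siteOp j m).mulVec ψ a = ∑ t, m (a j) t * ψ (Function.update a j t) := by
  have h : ∀ t, m (a j) t * ψ (Function.update a j t)
      = ∑ b, if b = Function.update a j t then m (a j) t * ψ b else 0 := by simp
  simp_rw [h]
  rw [Finset.sum_comm, Matrix.mulVec, dotProduct]
  refine Finset.sum_congr rfl fun b _ => ?_
  simp_rw [eq_update_iff, siteOp, ite_and]
  simp

theorem vecMul_siteOp (j : Fin L) (m : Matrix (Fin 2) (Fin 2) ℂ) (φ : Space L)
    (a : Fin L → Fin 2) :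
    Matrix.vecMul φ (siteOp j m) a = ∑ t, φ (Function.update a j t) * m t (a j) := by
  have h : siteOp j m = (siteOp j m.transpose).transpose := by
    ext a b
    simp only [siteOp, Matrix.transpose_apply, eq_comm]
  rw [h, Matrix.vecMul_transpose, siteOp_mulVec]
  simp [mul_comm]

theorem op_ext {M N : Op L} (h : ∀ ψ, M.mulVec ψ = N.mulVec ψ) : M = N :=
  Matrix.toLin'.injective (LinearMap.ext h)

theorem siteOp_mul (j : Fin L) (m n : Matrix (Fin 2) (Fin 2) ℂ) :
    siteOp j m * siteOp j n = siteOp j (m * n) := by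
  refine op_ext fun ψ => funext fun a => ?_
  rw [← Matrix.mulVec_mulVec]
  simp only [siteOp_mulVec, Function.update_self, Function.update_idem, Matrix.mul_apply,
    Fin.sum_univ_two]
  ring

theorem siteOp_commute {i j : Fin L} (hij : i ≠ j) (m n : Matrix (Fin 2) (Fin 2) ℂ) :
    Commute (siteOp i m) (siteOp j n) := by
  refine op_ext fun ψ => funext fun a => ?_
  rw [← Matrix.mulVec_mulVec, ← Matrix.mulVec_mulVec]
  simp only [siteOp_mulVec, Function.update_of_ne hij, Function.update_of_ne hij.symm,
    Function.update_comm hij, Fin.sum_univ_two]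
  ring

theorem siteOp_one (j : Fin L) : siteOp j 1 = 1 := by
  refine op_ext fun ψ => funext fun a => ?_
  simp [siteOp_mulVec, Matrix.one_apply]

theorem siteOp_add (j : Fin L) (m n : Matrix (Fin 2) (Fin 2) ℂ) :
    siteOp j (m + n) = siteOp j m + siteOp j n := by
  ext a b
  rw [Matrix.add_apply]
  simp only [siteOp, Matrix.add_apply, add_mul]

theorem siteOp_zero (j : Fin L) : siteOp j 0 = 0 := by
  ext a b
  simp [siteOp]

/-- The permutation of the auxiliary space and the site `j`. -/
def sitePerm (j : Fin L) : AuxOp L := fun a b => siteOp j (Matrix.single b a 1)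

theorem sites_sitePerm : Sites (sitePerm : Fin L → AuxOp L) := by
  refine ⟨fun j => ⟨fun a b c d => ?_, ?_⟩, fun i j hij a b c d => siteOp_commute hij _ _⟩
  · simp only [sitePerm, siteOp_mul]
    split_ifs with h
    · subst h; simp
    · rw [Matrix.single_mul_single_of_ne _ _ _ _ h, siteOp_zero]
  · rw [← siteOp_one j, sitePerm, sitePerm, ← siteOp_add]
    congr 1
    ext a b
    fin_cases a <;> fin_cases b <;> simp

theorem scal_eq_num (m : Matrix (Fin 2) (Fin 2) ℂ) : (scal m : AuxOp L) = num m := by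
  ext a b : 2
  rw [scal, num_apply, Algebra.algebraMap_eq_smul_one]

theorem localL_eq (c : ℂ) (s : Fin L → ℂ) (j : Fin L) (z : ℂ) :
    localL c s j z = lax (I * c) (sitePerm j) (z - s j) := by
  refine Matrix.ext fun a b => ?_
  simp only [localL, lax, Matrix.add_apply, Matrix.smul_apply, Matrix.one_apply, sitePerm]
  split_ifs <;> simp only [mul_one, mul_zero, zero_smul, smul_zero]

/-- The sites, the one nearest to the auxiliary space first. -/
def siteList (L : ℕ) : List (Fin L) := (List.finRange L).reverse

theorem nodup_siteList : (siteList L).Nodup := List.nodup_reverse.2 (List.nodup_finRange L)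

theorem T_eq_mono (c : ℂ) (s : Fin L → ℂ) (z : ℂ) :
    T c s z = mono (I * c) sitePerm s (siteList L) z := by
  simp only [T, mono, siteList, List.ofFn_eq_map, List.map_reverse, localL_eq]

theorem scal_σy_mul (M : AuxOp L) : scal σy * M.transpose * scal σy = adj M := by
  rw [scal_eq_num]
  ext a b : 2
  fin_cases a <;> fin_cases b <;>
    simp [Matrix.mul_apply, Fin.sum_univ_two, num_apply, σy, adj, Algebra.algebraMap_eq_smul_one,
      smul_smul]

/-! ### Diagonalization of the boundary matrices -/

/-- The matrix `N` in `K(z) = 1 + z N`. -/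
def Boundary.N (b : Boundary) : Matrix (Fin 2) (Fin 2) ℂ :=
  !![1 / b.ξ, 2 * b.κ * exp b.θ / b.ξ; 2 * b.κ * exp (-b.θ) / b.ξ, -(1 / b.ξ)]

theorem Boundary.K_eq (b : Boundary) (z : ℂ) : b.K z = 1 + z • b.N := by
  ext i j
  fin_cases i <;> fin_cases j <;> simp [Boundary.K, Boundary.N] <;> ring

theorem Boundary.N_trace (b : Boundary) : b.N.trace = 0 := by
  simp [Boundary.N, Matrix.trace_fin_two]

namespace Boundary.Admissible

variable {b : Boundary}

theorem cosh_ne (h : b.Admissible) : cosh b.β ≠ 0 := by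
  intro h0
  have h1 := h.α_cosh
  have h2 := h.ξ_ne
  have h3 := h.κ_ne
  rw [h0, mul_zero, eq_comm, div_eq_zero_iff] at h1
  rcases h1 with h1 | h1
  · exact h2 h1
  · exact h3 (by simpa using h1)

theorem α_ne (h : b.Admissible) : b.α ≠ 0 := by
  intro h0
  have h1 := h.α_cosh
  rw [h0, zero_mul, eq_comm, div_eq_zero_iff] at h1
  rcases h1 with h1 | h1
  · exact h.ξ_ne h1
  · exact h.κ_ne (by simpa using h1)

theorem N_sq (h : b.Admissible) : b.N * b.N = (1 / b.α ^ 2) • 1 := by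
  have h1 := h.α_cosh
  have h2 := h.sinh_β
  have h3 := Complex.cosh_sq_sub_sinh_sq b.β
  have hξ := h.ξ_ne
  have hκ := h.κ_ne
  have hα := h.α_ne
  -- Elimination of β from the two admissibility relations by cosh² - sinh² = 1.
  have key : 1 / b.α ^ 2 = (1 + 4 * b.κ ^ 2) / b.ξ ^ 2 := by
    rw [h2] at h3
    field_simp at h1 h3 ⊢
    linear_combination b.α ^ 2 * h3 - (b.ξ + 2 * b.κ * b.α * cosh b.β) * h1
  have he : exp b.θ * exp (-b.θ) = 1 := by rw [← Complex.exp_add, add_neg_cancel, Complex.exp_zero]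
  rw [key]
  ext i j
  fin_cases i <;> fin_cases j <;>
    simp [N, Matrix.mul_apply, Fin.sum_univ_two] <;> field_simp
  · linear_combination (4 * b.κ ^ 2) * he
  · ring
  · ring
  · linear_combination (4 * b.κ ^ 2) * he

theorem sqrt_sq (b : Boundary) :
    (2 * cosh b.β) ^ (1 / 2 : ℂ) * (2 * cosh b.β) ^ (1 / 2 : ℂ) = 2 * cosh b.β := by
  have := Complex.cpow_nat_inv_pow (2 * cosh b.β) two_ne_zero
  rw [← sq, one_div]
  exact_mod_cast this

theorem sqrt_ne (h : b.Admissible) : (2 * cosh b.β) ^ (1 / 2 : ℂ) ≠ 0 := by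
  intro h0
  have := sqrt_sq b
  rw [h0, mul_zero] at this
  exact mul_ne_zero two_ne_zero h.cosh_ne this.symm

/-- The entries of `M S`. -/
theorem MS_eq (b : Boundary) : b.M * b.S = ((2 * cosh b.β) ^ (1 / 2 : ℂ))⁻¹ •
    !![exp (b.θ / 2) * exp (b.β / 2), -(exp (b.θ / 2) * (exp (b.β / 2))⁻¹);
      (exp (b.θ / 2))⁻¹ * (exp (b.β / 2))⁻¹, (exp (b.θ / 2))⁻¹ * exp (b.β / 2)] := by
  have h1 : exp (-b.θ / 2) = (exp (b.θ / 2))⁻¹ := by rw [neg_div, Complex.exp_neg]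
  have h2 : exp (-b.β / 2) = (exp (b.β / 2))⁻¹ := by rw [neg_div, Complex.exp_neg]
  rw [Boundary.M, Boundary.S, h1, h2, Matrix.mul_smul]
  congr 1
  ext i j
  fin_cases i <;> fin_cases j <;> simp [Matrix.mul_apply, Fin.sum_univ_two]

theorem exp_half_mul (x : ℂ) : exp x = exp (x / 2) ^ 2 := by
  rw [← Complex.exp_nat_mul]; congr 1; push_cast; ring

theorem two_cosh (x : ℂ) : 2 * cosh x = exp (x / 2) ^ 2 + (exp (x / 2) ^ 2)⁻¹ := by
  rw [← exp_half_mul, ← Complex.exp_neg, Complex.two_cosh]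

theorem two_sinh (x : ℂ) : 2 * sinh x = exp (x / 2) ^ 2 - (exp (x / 2) ^ 2)⁻¹ := by
  rw [← exp_half_mul, ← Complex.exp_neg, Complex.two_sinh]

theorem det_MS (h : b.Admissible) : (b.M * b.S).det = 1 := by
  have h1 := sqrt_sq b
  have h2 := h.sqrt_ne
  have h3 := two_cosh b.β
  have hx := Complex.exp_ne_zero (b.θ / 2)
  have hy := Complex.exp_ne_zero (b.β / 2)
  rw [MS_eq, Matrix.det_smul, Fintype.card_fin, Matrix.det_fin_two_of]
  generalize (2 * cosh b.β) ^ (1 / 2 : ℂ) = r at *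
  generalize exp (b.θ / 2) = x at *
  generalize exp (b.β / 2) = y at *
  rw [h3] at h1
  field_simp at h1 ⊢
  linear_combination -h1

/-- The columns of `M S` are eigenvectors of `N` with eigenvalues ±1/α: this is the factorization of
K for which α and β were introduced. -/
theorem N_mul_MS (h : b.Admissible) :
    b.N * (b.M * b.S) = b.M * b.S * !![1 / b.α, 0; 0, -(1 / b.α)] := by
  have h3 := two_cosh b.β
  have h4 := two_sinh b.β
  have h5 := h.sinh_β
  have h6 := h.α_cosh
  have hx := Complex.exp_ne_zero (b.θ / 2)
  have hy := Complex.exp_ne_zero (b.β / 2)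
  have hξ := h.ξ_ne
  have hκ := h.κ_ne
  have hα := h.α_ne
  rw [MS_eq, Matrix.mul_smul, Matrix.smul_mul]
  congr 1
  rw [Boundary.N, Complex.exp_neg, exp_half_mul b.θ]
  generalize exp (b.θ / 2) = x at *
  generalize exp (b.β / 2) = y at *
  generalize cosh b.β = C at *
  generalize sinh b.β = D at *
  subst h5
  have hC : C = (y ^ 2 + (y ^ 2)⁻¹) / 2 := by rw [← h3]; ring
  subst hC
  field_simp at h4 h6
  ext i j
  fin_cases i <;> fin_cases j <;> simp [Matrix.mul_apply, Fin.sum_univ_two] <;> field_simp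
  · linear_combination b.α * h4 + h6
  · refine mul_left_cancel₀ (pow_ne_zero 2 hy) ?_
    linear_combination -b.α * h4 + h6
  · refine mul_left_cancel₀ (pow_ne_zero 2 hy) ?_
    linear_combination -b.α * h4 + h6
  · linear_combination -b.α * h4 - h6

end Boundary.Admissible

/-! ### The open chain as a dressed boundary matrix -/

theorem K_boundary (c : ℂ) (b : Boundary) (z : ℂ) :
    (scal (b.K (z - I * c / 2)) : AuxOp L) = boundary (I * c) b.N z := by
  rw [scal_eq_num, Boundary.K_eq, map_add, map_one, num_smul, boundary]

theorem dress_T (c : ℂ) (s : Fin L → ℂ) (bm : Boundary) (z : ℂ) :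
    dress c bm (T c s) z
      = chain (I * c) sitePerm s (boundary (I * c) bm.N) (siteList L) z := by
  rw [dress, scal_σy_mul, K_boundary, T_eq_mono, T_eq_mono, chain_eq sites_sitePerm _ _ _
    nodup_siteList]

theorem entriesCommute_boundary {A : Type*} [Ring A] [Algebra ℂ A] (M : Matrix (Fin 2) (Fin 2) A)
    (η : ℂ) (N : Matrix (Fin 2) (Fin 2) ℂ) (z : ℂ) : EntriesCommute M (boundary η N z) := by
  have h : (boundary η N z : Matrix (Fin 2) (Fin 2) A) = num (1 + (z - η / 2) • N) := by
    rw [map_add, map_one, num_smul, boundary]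
  exact h ▸ entriesCommute_num _ _

/-- The matrix `G = M S`. -/
def Boundary.G (b : Boundary) : Matrix (Fin 2) (Fin 2) ℂ := b.M * b.S

/-- The inverse of `G`. -/
def Boundary.Ginv (b : Boundary) : Matrix (Fin 2) (Fin 2) ℂ := (b.M * b.S)⁻¹

theorem Boundary.Admissible.Ginv_mul {b : Boundary} (h : b.Admissible) : b.Ginv * b.G = 1 :=
  Matrix.nonsing_inv_mul _ (by rw [h.det_MS]; exact isUnit_one)

theorem Boundary.Admissible.Ginv_eq {b : Boundary} (h : b.Admissible) :
    b.Ginv = !![b.G 1 1, -b.G 0 1; -b.G 1 0, b.G 0 0] := by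
  rw [Boundary.Ginv, Matrix.inv_def, h.det_MS, Ring.inverse_one, one_smul,
    Matrix.adjugate_fin_two, Boundary.G]

theorem Boundary.Admissible.Ginv_N_G {b : Boundary} (h : b.Admissible) :
    b.Ginv * b.N * b.G = !![1 / b.α, 0; 0, -(1 / b.α)] := by
  rw [mul_assoc, Boundary.G, h.N_mul_MS, ← mul_assoc]
  exact (congrArg (· * _) h.Ginv_mul).trans (one_mul _)

/-- The off-diagonal entry of K⁻ in the eigenbasis of K⁺ fixes the leading coefficient of ℬ. -/
theorem leadB_eq {bp bm : Boundary} (hp : bp.Admissible) (hm : bm.Admissible) :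
    (-1) ^ L * (bp.Ginv * bm.N * bp.G) 0 1 = 2 * leadB L bp bm := by
  have hs := Boundary.Admissible.sqrt_sq bp
  have hs0 := hp.sqrt_ne
  have hx := Complex.exp_ne_zero (bp.θ / 2)
  have hy := Complex.exp_ne_zero (bp.β / 2)
  have hw := Complex.exp_ne_zero (bm.θ / 2)
  have hξ := hm.ξ_ne
  have hsinh : 2 * sinh (bm.θ - bp.θ + bp.β)
      = exp (bm.θ / 2) ^ 2 / exp (bp.θ / 2) ^ 2 * exp (bp.β / 2) ^ 2
        - exp (bp.θ / 2) ^ 2 / exp (bm.θ / 2) ^ 2 / exp (bp.β / 2) ^ 2 := by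
    rw [Complex.two_sinh, neg_add, neg_sub, Complex.exp_add, Complex.exp_add, Complex.exp_sub,
      Complex.exp_sub, Complex.exp_neg, Boundary.Admissible.exp_half_mul bm.θ,
      Boundary.Admissible.exp_half_mul bp.θ, Boundary.Admissible.exp_half_mul bp.β]
    ring
  have hsinh' : sinh (bm.θ - bp.θ + bp.β) = (2 * sinh (bm.θ - bp.θ + bp.β)) / 2 := by ring
  have hG := Boundary.Admissible.MS_eq bp
  rw [leadB, hsinh', hsinh, hp.Ginv_eq, Boundary.G, hG, Boundary.N, Complex.exp_neg bm.θ,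
    Boundary.Admissible.exp_half_mul bm.θ]
  have hp1 : ((-1 : ℂ) ^ L) * (-1) ^ L = 1 := by rw [← mul_pow]; simp
  have hp0 : ((-1 : ℂ) ^ L) ≠ 0 := pow_ne_zero _ (by norm_num)
  generalize (-1 : ℂ) ^ L = ε at *
  generalize (2 * cosh bp.β) ^ (1 / 2 : ℂ) = r at *
  rw [← hs]
  generalize exp (bp.θ / 2) = x at *
  generalize exp (bp.β / 2) = y at *
  generalize exp (bm.θ / 2) = w at *
  simp [Matrix.mul_apply, Fin.sum_univ_two]
  field_simp
  linear_combination (2 * bm.κ * (w ^ 4 * y ^ 4 - x ^ 4) - 2 * x ^ 2 * y ^ 2 * w ^ 2) * hp1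

theorem adj_num {A : Type*} [Ring A] [Algebra ℂ A] (m : Matrix (Fin 2) (Fin 2) ℂ) :
    adj (num m : Matrix (Fin 2) (Fin 2) A) = num !![m 1 1, -m 0 1; -m 1 0, m 0 0] := by
  ext i j
  fin_cases i <;> fin_cases j <;> simp [adj, num_apply]

/-! ### Quantum determinant and functional equations of the transfer matrix -/

section

variable (c : ℂ) (s : Fin L → ℂ) {bp bm : Boundary}

/-- Because det G = 1, `adj` of G⁻¹ is G; the twist G⁻¹T thus conjugates the whole double-row matrix
by G. -/
theorem U_eq (hp : bp.Admissible) (z : ℂ) :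
    U c s bp bm z = num bp.Ginv
      * chain (I * c) sitePerm s (boundary (I * c) bm.N) (siteList L) z * num bp.G := by
  have hadj : adj (num bp.Ginv : AuxOp L) = num bp.G := by
    rw [adj_num, hp.Ginv_eq]
    congr 1
    ext i j
    fin_cases i <;> fin_cases j <;> simp
  rw [← dress_T, U, dress, dress, scal_σy_mul, scal_σy_mul, twistedT, twistedT,
    adj_mul ((scal_eq_num (L := L) _) ▸ (entriesCommute_num _ _).symm), scal_eq_num (bp.M * bp.S)⁻¹]
  change _ = num bp.Ginv * _ * num bp.G
  rw [← hadj]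
  simp only [Boundary.Ginv, mul_assoc]

theorem comm_boundary (N : Matrix (Fin 2) (Fin 2) ℂ) (i : Fin L) (z : ℂ) :
    EntriesCommute (sitePerm i) (boundary (I * c) N z) := entriesCommute_boundary _ _ _ _

theorem parity_U (hp : bp.Admissible) : Parity (I * c) (U c s bp bm) := by
  rw [funext (U_eq c s (bm := bm) hp)]
  exact (sites_sitePerm.parity_chain s (comm_boundary c _) (parity_boundary _ bm.N_trace)
    nodup_siteList).conj hp.Ginv_mul

theorem reflection_U (hp : bp.Admissible) (hm : bm.Admissible) :
    Reflection (I * c) (U c s bp bm) := by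
  rw [funext (U_eq c s (bm := bm) hp)]
  exact (sites_sitePerm.reflection_chain s (comm_boundary c _) (reflection_boundary _ hm.N_sq)
    nodup_siteList).conj hp.Ginv_mul

theorem prod_siteList (f : Fin L → ℂ) : ((siteList L).map f).prod = ∏ l, f l := by
  rw [siteList, List.map_reverse, List.prod_reverse, ← List.ofFn_eq_map, List.prod_ofFn]

theorem unitary_U (hp : bp.Admissible) (hm : bm.Admissible) :
    Unitary (I * c) (fun z => (∏ l, siteDet (I * c) (s l) z) * (1 - z ^ 2 * (1 / bm.α ^ 2)))
      (U c s bp bm) := by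
  rw [funext (U_eq c s (bm := bm) hp)]
  simp only [← prod_siteList]
  exact (sites_sitePerm.unitary_chain s (unitary_boundary _ hm.N_sq) (siteList L)).conj hp.Ginv_mul

/-- The (0,0) entry of the parity relation: 𝒟~ carries no information beyond 𝒜 at the reflected
point. -/
theorem opDt_eq (hp : bp.Admissible) (z : ℂ) :
    opDt c s bp bm z = (2 * z - I * c) • opA c s bp bm (-z) := by
  have h := congrFun (congrFun ((parity_U c s (bm := bm) hp).add_neg z) 0) 0
  simp only [Matrix.add_apply, Matrix.smul_apply, Matrix.scalar_apply, Matrix.diagonal_apply_eq,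
    Matrix.trace_fin_two] at h
  rw [opDt, opA]
  linear_combination (norm := module) -h

theorem opCt_eq (hp : bp.Admissible) (z : ℂ) :
    opCt c s bp bm z = (-(2 * z - I * c)) • U c s bp bm (-z) 1 0 := by
  have h := congrFun (congrFun ((parity_U c s (bm := bm) hp).add_neg z) 1) 0
  simp only [Matrix.add_apply, Matrix.smul_apply, Matrix.scalar_apply] at h
  rw [Matrix.diagonal_apply_ne _ (by decide : (1 : Fin 2) ≠ 0)] at h
  rw [opCt]
  linear_combination (norm := module) h

theorem opA_mul_opA (hp : bp.Admissible) (hm : bm.Admissible) (z : ℂ) :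
    opA c s bp bm (z + I * c / 2) * opA c s bp bm (I * c / 2 - z)
      + opB c s bp bm (z + I * c / 2) * U c s bp bm (I * c / 2 - z) 1 0
      = ((∏ l, siteDet (I * c) (s l) z) * (1 - z ^ 2 * (1 / bm.α ^ 2))) • 1 := by
  have h := congrFun (congrFun (unitary_U c s hp hm z) 0) 0
  rwa [Matrix.mul_apply, Fin.sum_univ_two, Matrix.smul_apply, Matrix.one_apply_eq] at h

/-- The factorization of the scalar in the inversion relation that accounts for the form of Δ⁻. -/
theorem Δm_mul_Δm (hm : bm.Admissible) (z : ℂ) :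
    Δm c s bm (z + I * c / 2) * Δm c s bm (I * c / 2 - z)
      = (∏ l, siteDet (I * c) (s l) z) * (1 - z ^ 2 * (1 / bm.α ^ 2)) := by
  have hα := hm.α_ne
  have hp1 : ((-1 : ℂ) ^ L) * (-1) ^ L = 1 := by rw [← mul_pow]; simp
  have hp0 : ((-1 : ℂ) ^ L) ≠ 0 := pow_ne_zero _ (by norm_num)
  have hprod : (∏ l, siteDet (I * c) (s l) z)
      = (∏ l, ((z + I * c / 2 - s l + I * c / 2) * (z + I * c / 2 + s l + I * c / 2)))
        * ∏ l, ((I * c / 2 - z - s l + I * c / 2) * (I * c / 2 - z + s l + I * c / 2)) := by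
    rw [← Finset.prod_mul_distrib]
    refine Finset.prod_congr rfl fun l _ => ?_
    rw [siteDet]
    ring
  rw [Δm, Δm, hprod]
  generalize (-1 : ℂ) ^ L = ε at *
  generalize (∏ l, ((z + I * c / 2 - s l + I * c / 2) * (z + I * c / 2 + s l + I * c / 2))) = p
  generalize (∏ l, ((I * c / 2 - z - s l + I * c / 2) * (I * c / 2 - z + s l + I * c / 2))) = q
  field_simp
  linear_combination (4 * p * q * (z ^ 2 - bm.α ^ 2)) * hp1

theorem Δp_eq (z : ℂ) : Δp c s bm z = (2 * z - I * c) * Δm c s bm (-z) := by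
  have hprod : ∏ l, ((z - s l - I * c / 2) * (z + s l - I * c / 2))
      = ∏ l, ((-z - s l + I * c / 2) * (-z + s l + I * c / 2)) :=
    Finset.prod_congr rfl fun l _ => by ring
  rw [Δp, Δm, hprod]
  ring

/-- With 𝒟~ and 𝒞~ rewritten by parity, the quantum determinant is a multiple of the (0,0) entry of
the inversion relation. -/
theorem qdetOp_eq (hp : bp.Admissible) (hm : bm.Admissible) (z : ℂ) :
    qdetOp c s bp bm z = Δq c s bm z • (1 : Op L) := by
  have h := opA_mul_opA c s hp hm z
  have e : -(z - I * c / 2) = I * c / 2 - z := by ring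
  rw [qdetOp, opDt_eq c s hp, opCt_eq c s hp, Δq, Δp_eq, e]
  rw [← Δm_mul_Δm c s hm] at h
  simp only [mul_smul_comm]
  linear_combination (norm := module) (2 * (z - I * c / 2) - I * c) • h

theorem chain_append {A ι : Type*} [Ring A] [Algebra ℂ A] (η : ℂ)
    (P : ι → Matrix (Fin 2) (Fin 2) A) (s : ι → ℂ) (U : ℂ → Matrix (Fin 2) (Fin 2) A)
    (l l' : List ι) : chain η P s U (l ++ l') = chain η P s (chain η P s U l') l := by
  induction l with
  | nil => rfl
  | cons i l ih => funext z; simp only [List.cons_append, chain, ih]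

theorem siteDet_neg (η s z : ℂ) : siteDet η s (-z) = siteDet η s z := by
  rw [siteDet, siteDet]; ring

theorem τ_eq_pairing (z : ℂ) :
    τ c s bp bm z = (1 / 2 : ℂ) • pairing (boundary (I * c) (-bp.N) (-z))
      (chain (I * c) sitePerm s (boundary (I * c) bm.N) (siteList L) z) := by
  rw [τ, dress_T]
  congr 1
  generalize chain (I * c) sitePerm s (boundary (I * c) bm.N) (siteList L) z = Z
  have h : (boundary (I * c) (-bp.N) (-z) : Matrix (Fin 2) (Fin 2) (Op L)ᵐᵒᵖ)
      = num (bp.K (z + I * c / 2)) := by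
    have e : (-z - I * c / 2) • -bp.N = (z + I * c / 2) • bp.N := by module
    rw [boundary, ← num_smul, ← map_one num, ← map_add, e, Boundary.K_eq]
  rw [h, scal_eq_num]
  simp only [pairing, Matrix.trace, Matrix.diag_apply, Matrix.mul_apply, num_apply,
    MulOpposite.algebraMap_apply, MulOpposite.unop_op]

/-- K⁺ is 1 plus a multiple of the traceless `N`. Parity of the double-row matrix relates its traces
against `N` at z and -z, with the coefficients z ± η/2 that K⁺ supplies. -/
theorem τ_neg (z : ℂ) : τ c s bp bm (-z) = τ c s bp bm z := by
  have hp := sites_sitePerm.parity_chain s (comm_boundary c bm.N)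
    (parity_boundary (A := Op L) (I * c) bm.N_trace) nodup_siteList
  have key : ∀ z, (scal (bp.K (z + I * c / 2)) * dress c bm (T c s) z).trace
      = (dress c bm (T c s) z).trace
        + (z + I * c / 2) • (num bp.N * dress c bm (T c s) z).trace := by
    intro z
    rw [scal_eq_num, Boundary.K_eq, map_add, num_smul, map_one, add_mul, one_mul,
      Matrix.trace_add, smul_mul_assoc, Matrix.trace_smul]
  have h0 : ∀ t : Op L, (num bp.N * Matrix.scalar (Fin 2) t).trace = 0 := by
    intro t
    have := bp.N_trace
    rw [Matrix.trace_fin_two] at this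
    simp [Matrix.trace_fin_two, num_apply, ← add_mul, ← map_add, this]
  rw [τ, τ, key, key]
  refine congrArg _ ?_
  rw [funext (dress_T c s bm)]
  have h := congrArg (fun M => (num bp.N * M).trace) (hp.add_neg z)
  simp only [mul_add, mul_smul_comm, Matrix.trace_add, Matrix.trace_smul, h0, smul_zero] at h
  rw [hp.trace_neg]
  generalize (chain (I * c) sitePerm s (boundary (I * c) bm.N) (siteList L) z).trace = t at *
  generalize (num bp.N * chain (I * c) sitePerm s (boundary (I * c) bm.N) (siteList L) z).trace
    = t1 at *
  generalize (num bp.N * chain (I * c) sitePerm s (boundary (I * c) bm.N) (siteList L) (-z)).trace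
    = t2 at *
  linear_combination (norm := module) (-(1 / 2) : ℂ) • h

/-- The one-site inversion formula applied to site `j`. The factor 4s_j² - η² on the left keeps the
identity free of division; it matches the contribution of site `j` itself to the product on the
right. -/
theorem τ_mul_τ (hp : bp.Admissible) (hm : bm.Admissible) (j : Fin L) :
    (4 * s j ^ 2 - (I * c) ^ 2) •
        (τ c s bp bm (s j + I * c / 2) * τ c s bp bm (s j - I * c / 2))
      = ((s j ^ 2 - (I * c) ^ 2) * (∏ l, siteDet (I * c) (s l) (s j))
        * (1 - s j ^ 2 * (1 / bp.α ^ 2)) * (1 - s j ^ 2 * (1 / bm.α ^ 2))) • (1 : Op L) := by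
  have hmem : j ∈ siteList L := by simp [siteList]
  -- The sites in `l` lie outside `j` and join K⁺; those in `l'` lie inside and join K⁻.
  obtain ⟨l, l', hl⟩ := List.append_of_mem hmem
  have hnd := hl ▸ nodup_siteList (L := L)
  rw [List.nodup_append] at hnd
  obtain ⟨hnd1, hnd2, hnd3⟩ := hnd
  rw [List.nodup_cons] at hnd2
  have hj : j ∉ l := fun h => hnd3 j h j List.mem_cons_self rfl
  have hl' : ∀ i ∈ l, i ∉ l' := fun i hi h => hnd3 i hi i (List.mem_cons_of_mem _ h) rfl
  have htr : (-bp.N).trace = 0 := by rw [Matrix.trace_neg, bp.N_trace, neg_zero]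
  have hsq : -bp.N * -bp.N = (1 / bp.α ^ 2) • 1 := by rw [neg_mul_neg, hp.N_sq]
  obtain ⟨V, hV1, hV2, hV3, hV4⟩ := sites_sitePerm.exists_dual s l hnd1
    (boundary (I * c) (-bp.N)) _ (parity_boundary _ htr) (unitary_boundary _ hsq)
    fun i _ z => entriesCommute_boundary _ _ _ _
  have hM : ∀ z, EntriesCommute (sitePerm j)
      (chain (I * c) sitePerm s (boundary (I * c) bm.N) l' z) :=
    sites_sitePerm.comm_chain (comm_boundary c _) hnd2.1 _ _
  have hτ : ∀ z, τ c s bp bm z = (1 / 2 : ℂ) • pairing (V (-z)) (addSite (I * c) (sitePerm j)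
      (s j) z (chain (I * c) sitePerm s (boundary (I * c) bm.N) l' z)) := by
    intro z
    rw [τ_eq_pairing, hl, chain_append, hV4]
    · rfl
    · intro i hi w
      exact EntriesCommute.addSite (sites_sitePerm.comm i j fun h => hj (h ▸ hi))
        (sites_sitePerm.comm_chain (comm_boundary c _) (hl' i hi) _ _ _) _ _ _
  have hmain := pairing_addSite_mul (sites_sitePerm.perm j) (s := s j) hV1 hV2
    (sites_sitePerm.unitary_chain s (unitary_boundary (A := Op L) (I * c) hm.N_sq) l') hM
    (hV3 _ (fun i hi => sites_sitePerm.comm j i fun h => hj (h ▸ hi))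
      fun z => entriesCommute_boundary _ _ _ _)
    (fun z => hV3 _ (fun i hi => (sites_sitePerm.comm_chain (comm_boundary c _) (hl' i hi)
      _ _ _).symm) fun z => entriesCommute_boundary _ _ _ _)
  have hprod : ∏ i, siteDet (I * c) (s i) (s j)
      = (l.map fun i => siteDet (I * c) (s i) (s j)).prod * (siteDet (I * c) (s j) (s j)
        * (l'.map fun i => siteDet (I * c) (s i) (s j)).prod) := by
    rw [← prod_siteList, hl, List.map_append, List.prod_append, List.map_cons, List.prod_cons]
  have hs : siteDet (I * c) (s j) (s j) = -(I * c) ^ 2 * (4 * s j ^ 2 - (I * c) ^ 2) := by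
    rw [siteDet]; ring
  have e : s j - I * c / 2 = -(I * c / 2 - s j) := by ring
  rw [e, τ_neg, hτ, hτ, smul_mul_smul_comm, hmain, hprod, hs]
  simp only [siteDet_neg]
  module

theorem eigenvalue_mul (hp : bp.Admissible) (hm : bm.Admissible) {Λ : ℂ → ℂ} {ψ : Space L}
    (h : IsEigenpair c s bp bm Λ ψ) (j : Fin L) (h1 : 2 * s j - I * c ≠ 0)
    (h2 : 2 * s j + I * c ≠ 0) :
    Λ (s j + I * c / 2) * Λ (s j - I * c / 2) = -((s j + I * c) / 2)
      * ((s j - bp.α) / ((2 * s j - I * c) * bp.α))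
      * ((s j + bp.α) / ((2 * s j + I * c) * bp.α)) * Δq c s bm (s j) := by
  have hα := hp.α_ne
  have e := congrArg (fun M => Matrix.mulVec M ψ) (τ_mul_τ c s hp hm j)
  simp only [Matrix.smul_mulVec, ← Matrix.mulVec_mulVec, h.2, Matrix.mulVec_smul,
    Matrix.one_mulVec, smul_smul] at e
  -- The operator identity applied to ψ becomes a scalar one because ψ ≠ 0.
  have e' := smul_left_injective ℂ h.1 e
  have e0 : -(s j - I * c / 2) = I * c / 2 - s j := by ring
  have hq : Δq c s bm (s j) = (2 * (s j - I * c / 2) - I * c) *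
      ((∏ l, siteDet (I * c) (s l) (s j)) * (1 - s j ^ 2 * (1 / bm.α ^ 2))) := by
    rw [← Δm_mul_Δm c s hm, Δq, Δp_eq, e0]; ring
  rw [hq]
  refine mul_left_cancel₀ (mul_ne_zero h1 h2) ?_
  have h1' : s j * 2 - I * c ≠ 0 := by rwa [mul_comm] at h1
  have h2' : s j * 2 + I * c ≠ 0 := by rwa [mul_comm] at h2
  field_simp at e' ⊢
  linear_combination 2 * e'

end

/-! ### Continuity in the spectral parameter -/

section Continuity

theorem continuous_chain {A ι : Type*} [Ring A] [Algebra ℂ A] [TopologicalSpace A]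
    [IsTopologicalRing A] [ContinuousSMul ℂ A] (η : ℂ) (P : ι → Matrix (Fin 2) (Fin 2) A)
    (s : ι → ℂ) (N : Matrix (Fin 2) (Fin 2) ℂ) (l : List ι) :
    Continuous (chain η P s (boundary η N) l) := by
  induction l with
  | nil => simp only [chain, boundary]; fun_prop
  | cons i l ih => simp only [chain, addSite, lax]; fun_prop

theorem continuous_opB (c : ℂ) (s : Fin L → ℂ) {bp bm : Boundary} (hp : bp.Admissible) :
    Continuous (opB c s bp bm) := by
  have h : Continuous (U c s bp bm) := by
    rw [funext (U_eq c s (bm := bm) hp)]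
    have := continuous_chain (I * c) (sitePerm (L := L)) s bm.N (siteList L)
    fun_prop
  exact (continuous_apply_apply (0 : Fin 2) (1 : Fin 2)).comp h

end Continuity

/-! ### Left eigenvectors of ℬ and the action of 𝒜 on them -/

section Covectors

variable (c : ℂ) (s : Fin L → ℂ) (bp bm : Boundary)

/-- The eigenvalue of `ℬ(z)` with zeros `x`. -/
def eigB (x : Fin L → ℂ) (z : ℂ) : ℂ :=
  leadB L bp bm * (2 * z - I * c) * ∏ l, (z ^ 2 - x l ^ 2)

/-- `φ` is a left eigenvector of `ℬ(z)` for all `z`, with zeros `x`. -/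
def IsEigencovector (φ : Space L) (x : Fin L → ℂ) : Prop :=
  ∀ z, Matrix.vecMul φ (opB c s bp bm z) = eigB c bp bm x z • φ

variable {c s bp bm}

theorem eigB_eq_zero {x : Fin L → ℂ} {z : ℂ} {j : Fin L} (h : z ^ 2 = x j ^ 2) :
    eigB c bp bm x z = 0 := by
  rw [eigB, Finset.prod_eq_zero (Finset.mem_univ j) (by rw [h, sub_self]), mul_zero]

theorem eigB_update (x : Fin L → ℂ) (j : Fin L) (y z : ℂ) :
    (z ^ 2 - x j ^ 2) * eigB c bp bm (Function.update x j y) z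
      = (z ^ 2 - y ^ 2) * eigB c bp bm x z := by
  have h : ∏ l ∈ Finset.univ.erase j, (z ^ 2 - Function.update x j y l ^ 2)
      = ∏ l ∈ Finset.univ.erase j, (z ^ 2 - x l ^ 2) :=
    Finset.prod_congr rfl fun l hl => by rw [Function.update_of_ne (Finset.ne_of_mem_erase hl)]
  rw [eigB, eigB, ← Finset.mul_prod_erase _ _ (Finset.mem_univ j), h, Function.update_self,
    ← Finset.mul_prod_erase _ (fun l => z ^ 2 - x l ^ 2) (Finset.mem_univ j)]
  ring

theorem IsEigencovector.vecMul_opB {φ : Space L} {x : Fin L → ℂ}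
    (h : IsEigencovector c s bp bm φ x) {z : ℂ} {j : Fin L} (hz : z ^ 2 = x j ^ 2) :
    Matrix.vecMul φ (opB c s bp bm z) = 0 := by
  rw [h z, eigB_eq_zero hz, zero_smul]

theorem IsEigencovector.vecMul_opB_mul {φ : Space L} {x : Fin L → ℂ}
    (h : IsEigencovector c s bp bm φ x) {z : ℂ} {j : Fin L} (hz : z ^ 2 = x j ^ 2) (M : Op L) :
    Matrix.vecMul φ (opB c s bp bm z * M) = 0 := by
  rw [← Matrix.vecMul_vecMul, h.vecMul_opB hz, Matrix.zero_vecMul]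

/-- In the exchange relation of ℬ(z) with 𝒜(μ) the unwanted terms start with ℬ(μ), which kills φ.
What remains multiplies the eigenvalue by (z² - (μ - η)²)/(z² - μ²), that is, moves one zero. -/
theorem IsEigencovector.vecMul_opA (hp : bp.Admissible) (hm : bm.Admissible) {φ : Space L}
    {x : Fin L → ℂ} (h : IsEigencovector c s bp bm φ x) {μ y : ℂ} {j : Fin L}
    (hμ : μ ^ 2 = x j ^ 2) (hy : y ^ 2 = (μ - I * c) ^ 2) :
    IsEigencovector c s bp bm (Matrix.vecMul φ (opA c s bp bm μ)) (Function.update x j y) := by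
  have key : ∀ z, (z ^ 2 - μ ^ 2) •
      (Matrix.vecMul (Matrix.vecMul φ (opA c s bp bm μ)) (opB c s bp bm z)
        - eigB c bp bm (Function.update x j y) z • Matrix.vecMul φ (opA c s bp bm μ)) = 0 := by
    intro z
    have e := congrArg (Matrix.vecMul φ) ((reflection_U c s hp hm).apply_BA z μ)
    have e1 := h.vecMul_opB_mul hμ (U c s bp bm z 1 1)
    have e2 := h.vecMul_opB_mul hμ (U c s bp bm z 0 0)
    have e3 := h z
    have e4 := eigB_update (c := c) (bp := bp) (bm := bm) x j y z
    rw [opB] at e1 e2 e3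
    simp only [Matrix.vecMul_add, Matrix.vecMul_smul, e1, e2, smul_zero, add_zero] at e
    rw [← Matrix.vecMul_vecMul, e3, ← Matrix.vecMul_vecMul, Matrix.smul_vecMul] at e
    rw [smul_sub, smul_smul, hμ, e4, hy, opA, opB]
    rw [sub_eq_zero]
    rw [← hμ]
    linear_combination (norm := module) -e
  have hcont : Continuous fun z => Matrix.vecMul (Matrix.vecMul φ (opA c s bp bm μ))
        (opB c s bp bm z)
        - eigB c bp bm (Function.update x j y) z • Matrix.vecMul φ (opA c s bp bm μ) := by
    have := continuous_opB c s (bm := bm) hp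
    have h2 : Continuous (eigB c bp bm (Function.update x j y)) := by
      unfold eigB; fun_prop
    refine Continuous.sub ?_ (by fun_prop)
    exact Continuous.matrix_vecMul continuous_const this
  -- At z = ±μ the factor z² - μ² cannot be cancelled, so the identity is extended there by
  -- continuity.
  have hd : Dense ({μ, -μ}ᶜ : Set ℂ) := (Set.toFinite _).countable.dense_compl ℝ
  intro z
  have := Continuous.ext_on hd hcont (continuous_const (y := 0)) fun z hz => by
    have hne : z ^ 2 - μ ^ 2 ≠ 0 := by
      rw [sub_ne_zero, Ne, sq_eq_sq_iff_eq_or_eq_neg]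
      exact hz
    exact (smul_eq_zero.mp (key z)).resolve_left hne
  exact sub_eq_zero.mp (congrFun this z)

/-- The reference left eigenvector. -/
def refCov (b : Boundary) : Space L := fun a => ∏ l, b.Ginv 0 (a l)

/-- The permutation exchanges two equal factors, the row of G⁻¹ in the auxiliary space and the same
row at site `j`. -/
theorem refCov_sitePerm (b : Boundary) (j : Fin L) (d : Fin 2) :
    Matrix.vecMul (refCov b) (∑ a, b.Ginv 0 a • sitePerm j a d) = b.Ginv 0 d • refCov b := by
  funext x
  have h : ∀ t, refCov b (Function.update x j t)
      = b.Ginv 0 t * ∏ l ∈ Finset.univ.erase j, b.Ginv 0 (x l) := by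
    intro t
    rw [refCov, ← Finset.mul_prod_erase _ _ (Finset.mem_univ j), Function.update_self]
    congr 1
    exact Finset.prod_congr rfl fun l hl => by rw [Function.update_of_ne (Finset.ne_of_mem_erase hl)]
  have hx : refCov b x = b.Ginv 0 (x j) * ∏ l ∈ Finset.univ.erase j, b.Ginv 0 (x l) := by
    simpa using h (x j)
  rw [Fin.sum_univ_two, Matrix.vecMul_add, Matrix.vecMul_smul, Matrix.vecMul_smul, Pi.add_apply,
    Pi.smul_apply, Pi.smul_apply, sitePerm, sitePerm, vecMul_siteOp, vecMul_siteOp, Pi.smul_apply,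
    hx]
  simp only [h]
  generalize x j = k
  fin_cases d <;> fin_cases k <;> simp [Fin.sum_univ_two] <;> ring

theorem refCov_mono (b : Boundary) (l : List (Fin L)) (u : ℂ) (d : Fin 2) :
    Matrix.vecMul (refCov b) (∑ a, b.Ginv 0 a • mono (I * c) sitePerm s l u a d)
      = ((l.map fun i => u - s i + I * c).prod * b.Ginv 0 d) • refCov b := by
  induction l generalizing d with
  | nil =>
    have : ∑ a, b.Ginv 0 a • (1 : AuxOp L) a d = b.Ginv 0 d • 1 := by
      rw [Fin.sum_univ_two, Matrix.one_apply, Matrix.one_apply]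
      fin_cases d <;> simp
    simp only [mono, List.map_nil, List.prod_nil, this, one_mul, Matrix.vecMul_smul,
      Matrix.vecMul_one]
  | cons i l ih =>
    have hlax : ∀ e, Matrix.vecMul (refCov b)
        (∑ a, b.Ginv 0 a • lax (I * c) (sitePerm i) (u - s i) a e) = ((u - s i + I * c) * b.Ginv 0 e) • refCov b := by
      intro e
      have h1 : ∑ a, b.Ginv 0 a • lax (I * c) (sitePerm i) (u - s i) a e
          = ((u - s i) * b.Ginv 0 e) • (1 : Op L)
            + (I * c) • ∑ a, b.Ginv 0 a • sitePerm i a e := by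
        fin_cases e <;> simp [Fin.sum_univ_two, lax] <;> module
      rw [h1, Matrix.vecMul_add, Matrix.vecMul_smul, Matrix.vecMul_smul, refCov_sitePerm,
        Matrix.vecMul_one]
      module
    have h2 : ∑ a, b.Ginv 0 a • mono (I * c) sitePerm s (i :: l) u a d
        = ∑ e, (∑ a, b.Ginv 0 a • lax (I * c) (sitePerm i) (u - s i) a e)
          * mono (I * c) sitePerm s l u e d := by
      simp only [mono, List.map_cons, List.prod_cons, Matrix.mul_apply, Fin.sum_univ_two, add_mul,
        smul_add, smul_mul_assoc]
      abel
    have h3 := ih d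
    rw [Fin.sum_univ_two, Matrix.vecMul_add, Matrix.vecMul_smul, Matrix.vecMul_smul] at h3
    rw [h2, Fin.sum_univ_two, Matrix.vecMul_add, ← Matrix.vecMul_vecMul, ← Matrix.vecMul_vecMul,
      hlax, hlax, Matrix.smul_vecMul, Matrix.smul_vecMul, List.map_cons, List.prod_cons]
    linear_combination (norm := module) (u - s i + I * c) • h3

/-- As det G = 1, the second column of `G` is built from the first row of G⁻¹. Hence ℬ involves both
monodromy matrices only through their contraction with that row, which `refCov` turns into numbers.
-/
theorem isEigencovector_refCov (hp : bp.Admissible) (hm : bm.Admissible) :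
    IsEigencovector c s bp bm (refCov bp) fun l => s l - I * c / 2 := by
  intro z
  set X := mono (I * c) sitePerm s (siteList L) (z - I * c / 2) with hX
  set Y := mono (I * c) sitePerm s (siteList L) (-z - I * c / 2) with hY
  have hG1 : bp.G 0 1 = -bp.Ginv 0 1 := by rw [hp.Ginv_eq]; simp
  have hG2 : bp.G 1 1 = bp.Ginv 0 0 := by rw [hp.Ginv_eq]; simp
  have hB : opB c s bp bm z = ∑ e, ((∑ a, bp.Ginv 0 a • X a e)
      * (bm.K (z - I * c / 2) e 1 • ∑ a, bp.Ginv 0 a • Y a 0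
        - bm.K (z - I * c / 2) e 0 • ∑ a, bp.Ginv 0 a • Y a 1)) := by
    rw [opB, U_eq c s hp, chain_eq sites_sitePerm _ _ _ nodup_siteList, ← K_boundary, scal_eq_num,
      ← hX, ← hY]
    simp only [Matrix.mul_apply, Fin.sum_univ_two, num_apply, Algebra.algebraMap_eq_smul_one, adj,
      hG1, hG2, Matrix.of_apply, Matrix.cons_val_zero, Matrix.cons_val_one, Matrix.cons_val',
      smul_mul_assoc, mul_smul_comm, one_mul, mul_one, mul_neg, add_mul, mul_add, mul_sub]
    module
  have hXe : ∀ e, Matrix.vecMul (refCov bp) (∑ a, bp.Ginv 0 a • X a e)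
      = ((∏ l, (z - I * c / 2 - s l + I * c)) * bp.Ginv 0 e) • refCov bp := fun e => by
    rw [hX, refCov_mono, prod_siteList]
  have hYe : ∀ e, Matrix.vecMul (refCov bp) (∑ a, bp.Ginv 0 a • Y a e)
      = ((∏ l, (-z - I * c / 2 - s l + I * c)) * bp.Ginv 0 e) • refCov bp := fun e => by
    rw [hY, refCov_mono, prod_siteList]
  have hlead := leadB_eq (L := L) hp hm
  -- The identity part of K⁻ = 1 + (z - η/2) N has no off-diagonal entry after conjugation; this is
  -- the source of the factor 2z - ic in ℬ.
  have h01 : (bp.Ginv * bm.K (z - I * c / 2) * bp.G) 0 1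
      = (z - I * c / 2) * (bp.Ginv * bm.N * bp.G) 0 1 := by
    rw [Boundary.K_eq, mul_add, mul_one, add_mul, hp.Ginv_mul, mul_smul_comm, smul_mul_assoc]
    simp
  have hprod : (∏ l, (z - I * c / 2 - s l + I * c)) * ∏ l, (-z - I * c / 2 - s l + I * c)
      = (-1) ^ L * ∏ l, (z ^ 2 - (s l - I * c / 2) ^ 2) := by
    have : ((-1 : ℂ)) ^ L = ∏ _l : Fin L, (-1) := by simp
    rw [this, ← Finset.prod_mul_distrib, ← Finset.prod_mul_distrib]
    exact Finset.prod_congr rfl fun l _ => by ring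
  simp only [Matrix.mul_apply, Fin.sum_univ_two] at h01 hlead
  rw [hG1, hG2] at h01 hlead
  rw [hB, Fin.sum_univ_two, Matrix.vecMul_add, ← Matrix.vecMul_vecMul, ← Matrix.vecMul_vecMul,
    hXe, hXe]
  simp only [Matrix.smul_vecMul, Matrix.vecMul_sub, Matrix.vecMul_smul, hYe, smul_smul, eigB,
    ← sub_smul, ← add_smul]
  congr 1
  generalize ∏ l, (z - I * c / 2 - s l + I * c) = p at *
  generalize ∏ l, (-z - I * c / 2 - s l + I * c) = q at *
  linear_combination p * q * h01
    + ((z - I * c / 2) * ((bp.Ginv 0 0 * bm.N 0 0 + bp.Ginv 0 1 * bm.N 1 0) * -bp.Ginv 0 1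
      + (bp.Ginv 0 0 * bm.N 0 1 + bp.Ginv 0 1 * bm.N 1 1) * bp.Ginv 0 0)) * hprod
    + (z - I * c / 2) * (∏ l, (z ^ 2 - (s l - I * c / 2) ^ 2)) * hlead

/-- The commutator of two 𝒜's consists of terms starting with ℬ(μ) or ℬ(ν), both of which annihilate
φ. -/
theorem IsEigencovector.vecMul_opA_comm (hp : bp.Admissible) (hm : bm.Admissible) {φ : Space L}
    {x : Fin L → ℂ} (h : IsEigencovector c s bp bm φ x) {μ ν : ℂ} {i j : Fin L}
    (hμ : μ ^ 2 = x i ^ 2) (hν : ν ^ 2 = x j ^ 2) (h1 : μ - ν + I * c ≠ 0) (h2 : μ + ν ≠ 0) :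
    Matrix.vecMul (Matrix.vecMul φ (opA c s bp bm μ)) (opA c s bp bm ν)
      = Matrix.vecMul (Matrix.vecMul φ (opA c s bp bm ν)) (opA c s bp bm μ) := by
  have e := congrArg (Matrix.vecMul φ) ((reflection_U c s hp hm).apply_AA μ ν)
  have e1 := h.vecMul_opB_mul hμ (U c s bp bm ν 1 0)
  have e2 := h.vecMul_opB_mul hν (U c s bp bm μ 1 0)
  rw [opB] at e1 e2
  simp only [Matrix.vecMul_sub, Matrix.vecMul_smul, e1, e2, sub_zero, smul_zero] at e
  rw [Matrix.vecMul_vecMul, Matrix.vecMul_vecMul]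
  exact sub_eq_zero.mp ((smul_eq_zero.mp e).resolve_left (mul_ne_zero h1 h2))

/-- The inversion relation with its ℬ𝒞 term killed by φ: the move made by 𝒜(μ) is undone by 𝒜(η -
μ). -/
theorem IsEigencovector.vecMul_opA_opA (hp : bp.Admissible) (hm : bm.Admissible) {φ : Space L}
    {x : Fin L → ℂ} (h : IsEigencovector c s bp bm φ x) {μ : ℂ} {j : Fin L}
    (hμ : μ ^ 2 = x j ^ 2) :
    Matrix.vecMul (Matrix.vecMul φ (opA c s bp bm μ)) (opA c s bp bm (I * c - μ))
      = (Δm c s bm μ * Δm c s bm (I * c - μ)) • φ := by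
  have e := congrArg (Matrix.vecMul φ) (opA_mul_opA c s (bm := bm) hp hm (μ - I * c / 2))
  have e1 : μ - I * c / 2 + I * c / 2 = μ := by ring
  have e2 : I * c / 2 - (μ - I * c / 2) = I * c - μ := by ring
  rw [← Δm_mul_Δm c s hm, e1, e2, Matrix.vecMul_add, h.vecMul_opB_mul hμ, add_zero,
    Matrix.vecMul_smul, Matrix.vecMul_one] at e
  rw [Matrix.vecMul_vecMul, e]

end Covectors

/-! ### The lattice and the zeros of Δ⁻ -/

/-- The two nodes at a site. -/
def node (c : ℂ) (s : Fin L → ℂ) (j : Fin L) (b : Bool) : ℂ :=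
  if b then s j + I * c / 2 else s j - I * c / 2

/-- The points of the lattice. -/
def pt (c : ℂ) (s : Fin L → ℂ) (h : Fin L → Bool) (l : Fin L) : ℂ := node c s l (h l)

section Nodes

variable {c : ℂ} {s : Fin L → ℂ} {bp bm : Boundary}

theorem node_mem (j : Fin L) (b : Bool) : node c s j b ∈ nodes c s j := by
  cases b <;> simp [node, nodes]

theorem pt_update (h : Fin L → Bool) (j : Fin L) (b : Bool) :
    pt c s (Function.update h j b) = Function.update (pt c s h) j (node c s j b) := by
  funext l
  by_cases hl : l = j
  · subst hl; simp [pt]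
  · simp [pt, hl]

theorem node_true_eq (c : ℂ) (s : Fin L → ℂ) (j : Fin L) :
    node c s j true = node c s j false + I * c := by
  simp only [node, if_true, Bool.false_eq_true, if_false]; ring

theorem eq_node (c : ℂ) (s : Fin L → ℂ) (j : Fin L) : s j = node c s j false + I * c / 2 := by
  simp [node]

theorem Δm_eq_prod (z : ℂ) : Δm c s bm z = (z - I * c / 2 + bm.α) / ((-1) ^ L * bm.α) *
    ∏ l, ((z - node c s l false) * (z + node c s l true)) := by
  rw [Δm]
  congr 1
  refine Finset.prod_congr rfl fun l _ => ?_
  rw [node_true_eq, eq_node c s l]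
  ring

theorem Δm_node_false (j : Fin L) : Δm c s bm (node c s j false) = 0 := by
  rw [Δm_eq_prod, Finset.prod_eq_zero (Finset.mem_univ j) (by rw [sub_self, zero_mul]), mul_zero]

theorem Δm_neg_node_true (j : Fin L) : Δm c s bm (-node c s j true) = 0 := by
  rw [Δm_eq_prod, Finset.prod_eq_zero (Finset.mem_univ j) (by rw [neg_add_cancel, mul_zero]),
    mul_zero]

theorem Generic.node_sq_ne (hg : Generic c s bp bm) {j l : Fin L} (h : j ≠ l) (b b' : Bool) :
    node c s j b ^ 2 ≠ node c s l b' ^ 2 :=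
  hg.nodes_sq_ne j l h _ (node_mem j b) _ (node_mem l b')

theorem Generic.node_ne_zero (hg : Generic c s bp bm) (j : Fin L) (b : Bool) :
    node c s j b ≠ 0 := (hg.nodes_ne j _ (node_mem j b)).1

theorem Generic.node_sub_ne (hg : Generic c s bp bm) (j : Fin L) (b : Bool) :
    2 * node c s j b - I * c ≠ 0 := fun h =>
  (hg.nodes_ne j _ (node_mem j b)).2.1 (by linear_combination h / 2)

theorem Generic.node_add_ne (hg : Generic c s bp bm) (j : Fin L) (b : Bool) :
    2 * node c s j b + I * c ≠ 0 := fun h =>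
  (hg.nodes_ne j _ (node_mem j b)).2.2 (by linear_combination h / 2)

theorem I_mul_ne (hc : c ≠ 0) : I * c ≠ 0 := mul_ne_zero I_ne_zero hc

/-- Nodes of the same kind never differ by a sign. -/
theorem Generic.node_add_node_ne (hg : Generic c s bp bm) (j l : Fin L) (b : Bool) :
    node c s j b + node c s l b ≠ 0 := by
  intro h
  by_cases hjl : j = l
  · subst hjl
    exact hg.node_ne_zero j b (by linear_combination h / 2)
  · exact hg.node_sq_ne hjl b b (by linear_combination (node c s j b - node c s l b) * h)

theorem Generic.node_true_sub_ne (hg : Generic c s bp bm) (hc : c ≠ 0) (j l : Fin L) :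
    node c s j true - node c s l false ≠ 0 := by
  intro h
  by_cases hjl : j = l
  · subst hjl
    rw [node_true_eq] at h
    exact I_mul_ne hc (by linear_combination h)
  · exact hg.node_sq_ne hjl true false
      (by linear_combination (node c s j true + node c s l false) * h)

/-- The boundary factor here is proportional to α⁻ - s_j; the other factors are differences and sums
of nodes, excluded by genericity. -/
theorem Generic.Δm_neg_node_ne (hg : Generic c s bp bm) (hc : c ≠ 0) (hm : bm.Admissible)
    (j : Fin L) : Δm c s bm (-node c s j false) ≠ 0 := by
  rw [Δm_eq_prod]
  refine mul_ne_zero (div_ne_zero ?_ (mul_ne_zero (pow_ne_zero _ (by norm_num)) hm.α_ne))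
    (Finset.prod_ne_zero_iff.2 fun l _ => mul_ne_zero ?_ ?_)
  · intro h
    exact (hg.s_ne_α j).1 (by rw [eq_node c s j]; linear_combination -h)
  · intro h
    exact hg.node_add_node_ne j l false (by linear_combination -h)
  · intro h
    exact hg.node_true_sub_ne hc l j (by linear_combination h)

theorem Generic.Δm_node_ne (hg : Generic c s bp bm) (hc : c ≠ 0) (hm : bm.Admissible)
    (j : Fin L) : Δm c s bm (node c s j true) ≠ 0 := by
  rw [Δm_eq_prod]
  refine mul_ne_zero (div_ne_zero ?_ (mul_ne_zero (pow_ne_zero _ (by norm_num)) hm.α_ne))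
    (Finset.prod_ne_zero_iff.2 fun l _ => mul_ne_zero ?_ ?_)
  · intro h
    rw [node_true_eq] at h
    exact (hg.s_ne_α j).2 (by rw [eq_node c s j]; linear_combination h)
  · exact hg.node_true_sub_ne hc j l
  · exact hg.node_add_node_ne j l true

end Nodes

/-! ### A family of covectors indexed by the lattice -/

section Basis

variable {c : ℂ} {s : Fin L → ℂ} {bp bm : Boundary}

/-- Left eigenvectors of `ℬ` for all points of the lattice, connected by `𝒜`. -/
structure IsCovectorBasis (c : ℂ) (s : Fin L → ℂ) (bp bm : Boundary) (S : Finset (Fin L))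
    (v : (Fin L → Bool) → Space L) : Prop where
  eig : ∀ h, (∀ l, l ∉ S → h l = false) → IsEigencovector c s bp bm (v h) (pt c s h)
  ne : ∀ h, (∀ l, l ∉ S → h l = false) → v h ≠ 0
  raise : ∀ h, (∀ l, l ∉ S → h l = false) → ∀ j ∈ S, h j = false →
    Matrix.vecMul (v h) (opA c s bp bm (-node c s j false))
      = Δm c s bm (-node c s j false) • v (Function.update h j true)

theorem IsEigencovector.smul {φ : Space L} {x : Fin L → ℂ} (h : IsEigencovector c s bp bm φ x)
    (a : ℂ) : IsEigencovector c s bp bm (a • φ) x := fun z => by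
  rw [Matrix.smul_vecMul, h z, smul_comm]

theorem IsEigencovector.raise (hp : bp.Admissible) (hm : bm.Admissible) {φ : Space L}
    {h : Fin L → Bool} (hφ : IsEigencovector c s bp bm φ (pt c s h)) {j : Fin L}
    (hj : h j = false) :
    IsEigencovector c s bp bm (Matrix.vecMul φ (opA c s bp bm (-node c s j false)))
      (pt c s (Function.update h j true)) := by
  rw [pt_update]
  refine hφ.vecMul_opA hp hm ?_ ?_
  · rw [pt, hj, neg_sq]
  · rw [node_true_eq]; ring

theorem refCov_ne (hp : bp.Admissible) : (refCov bp : Space L) ≠ 0 := by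
  obtain ⟨k, hk⟩ : ∃ k, bp.Ginv 0 k ≠ 0 := by
    by_contra! h
    have := congrFun (congrFun hp.Ginv_mul 0) 0
    simp [Matrix.mul_apply, h] at this
  intro h
  have h1 := congrFun h fun _ => k
  rw [refCov, Finset.prod_const, Pi.zero_apply] at h1
  exact hk (eq_zero_of_pow_eq_zero h1)

/-- Induction on the set `S` of sites allowed to leave their lower node, starting from the reference
covector. -/
theorem Generic.exists_covectorBasis (hg : Generic c s bp bm) (hc : c ≠ 0) (hp : bp.Admissible)
    (hm : bm.Admissible) (S : Finset (Fin L)) :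
    ∃ v, IsCovectorBasis c s bp bm S v := by
  classical
  induction S using Finset.induction_on with
  | empty =>
    have h0 : ∀ h : Fin L → Bool, (∀ l, l ∉ (∅ : Finset (Fin L)) → h l = false) →
        pt c s h = fun l => s l - I * c / 2 := by
      intro h hh
      funext l
      rw [pt, hh l (Finset.notMem_empty l), node, if_neg Bool.false_ne_true]
    refine ⟨fun _ => refCov bp, fun h hh => ?_, fun _ _ => refCov_ne hp,
      fun _ _ j hj => absurd hj (Finset.notMem_empty j)⟩
    rw [h0 h hh]
    exact isEigencovector_refCov hp hm
  | insert i S hi ih =>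
    obtain ⟨v, hv⟩ := ih
    have hd := hg.Δm_neg_node_ne hc hm i
    have hS : ∀ h : Fin L → Bool, (∀ l, l ∉ insert i S → h l = false) →
        ∀ l, l ∉ S → Function.update h i false l = false := by
      intro h hh l hl
      by_cases hli : l = i
      · subst hli; simp
      · rw [Function.update_of_ne hli]
        exact hh l (by simp [hli, hl])
    have hS' : ∀ h : Fin L → Bool, (∀ l, l ∉ insert i S → h l = false) → h i = false →
        ∀ l, l ∉ S → h l = false := by
      intro h hh h0 l hl
      have := hS h hh l hl
      rw [← h0, Function.update_eq_self] at this
      exact this.trans h0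
    -- Site `i` is raised by 𝒜(-x_i), since (-x_i - η)² = (x_i + η)² moves the zero up. Division by
    -- Δ⁻(-x_i) is the normalization demanded by `raise`.
    refine ⟨fun h => if h i then (Δm c s bm (-node c s i false))⁻¹ •
      Matrix.vecMul (v (Function.update h i false)) (opA c s bp bm (-node c s i false)) else v h,
      fun h hh => ?_, fun h hh => ?_, fun h hh j hj hj0 => ?_⟩
    · by_cases h0 : h i
      · simp only [h0, if_true]
        have := (hv.eig _ (hS h hh)).raise hp hm (Function.update_self i false h)
        rw [Function.update_idem, ← h0, Function.update_eq_self] at this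
        exact this.smul _
      · simp only [h0]
        exact hv.eig h (hS' h hh (by simpa using h0))
    · by_cases h0 : h i
      · simp only [h0, if_true]
        -- If raising gave 0, lowering back would also give 0, yet it returns a nonzero multiple of
        -- the original covector.
        refine smul_ne_zero (inv_ne_zero hd) fun hzero => ?_
        have e : I * c - -node c s i false = node c s i true := by rw [node_true_eq]; ring
        have := (hv.eig _ (hS h hh)).vecMul_opA_opA hp hm (μ := -node c s i false) (j := i)
          (by rw [pt, Function.update_self, neg_sq])
        rw [hzero, Matrix.zero_vecMul, e, eq_comm] at this
        exact smul_ne_zero (mul_ne_zero hd (hg.Δm_node_ne hc hm i)) (hv.ne _ (hS h hh)) this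
      · simp only [h0]
        exact hv.ne h (hS' h hh (by simpa using h0))
    · by_cases hji : j = i
      · subst hji
        simp only [hj0, Bool.false_eq_true, if_false, Function.update_self, if_true,
          Function.update_idem]
        rw [smul_smul, mul_inv_cancel₀ hd, one_smul, ← hj0, Function.update_eq_self]
      · have hjS : j ∈ S := (Finset.mem_insert.1 hj).resolve_left hji
        simp only [Function.update_of_ne (Ne.symm hji)]
        by_cases h0 : h i
        · simp only [h0, if_true]
          -- Raising `j` after `i` is compared with raising `i` after `j`, for which the induction
          -- hypothesis applies.
          have e1 := hv.raise _ (hS h hh) j hjS (by rw [Function.update_of_ne hji, hj0])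
          have e2 := (hv.eig _ (hS h hh)).vecMul_opA_comm hp hm (μ := -node c s i false)
            (ν := -node c s j false) (i := i) (j := j)
            (by rw [pt, Function.update_self, neg_sq])
            (by rw [pt, Function.update_of_ne hji, hj0, neg_sq])
            (fun h => hg.node_true_sub_ne hc j i (by rw [node_true_eq]; linear_combination h))
            (fun h => hg.node_add_node_ne i j false (by linear_combination -h))
          rw [Matrix.smul_vecMul, e2, e1, Matrix.smul_vecMul, smul_comm,
            Function.update_comm hji]
        · simp only [h0]
          exact hv.raise h (hS' h hh (by simpa using h0)) j hjS hj0

end Basis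

/-! ### Independence of the covectors and steps off the lattice -/

section Independence

/-- Common eigenvectors with pairwise distinct eigenvalue functions are independent. -/
theorem linearIndependent_of_eigenvalues {κ Z K V : Type*} [Field K] [AddCommGroup V] [Module K V]
    (f : Z → V →ₗ[K] V) (χ : κ → Z → K) (w : κ → V) (hw : ∀ k, w k ≠ 0)
    (hf : ∀ k z, f z (w k) = χ k z • w k) (hχ : ∀ k k', k ≠ k' → ∃ z, χ k z ≠ χ k' z) :
    LinearIndependent K w := by
  classical
  rw [linearIndependent_iff']
  intro t
  induction t using Finset.induction_on with
  | empty => intro g _ k hk; exact absurd hk (Finset.notMem_empty k)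
  | insert a t ha ih =>
    intro g hg
    rw [Finset.sum_insert ha] at hg
    have ht : ∀ k ∈ t, g k = 0 := by
      intro k hk
      obtain ⟨z, hz⟩ := hχ k a fun h => ha (h ▸ hk)
      have h1 : ∑ k ∈ t, (g k * (χ k z - χ a z)) • w k = 0 := by
        have h2 := congrArg (f z) hg
        have h3 := congrArg (χ a z • ·) hg
        simp only [map_add, map_sum, map_smul, hf, map_zero, Finset.smul_sum, smul_add,
          smul_zero] at h2 h3
        have h4 : ∀ k, (g k * (χ k z - χ a z)) • w k
            = g k • χ k z • w k - χ a z • g k • w k := fun k => by module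
        simp only [h4, Finset.sum_sub_distrib]
        linear_combination (norm := module) h2 - h3
      exact (mul_eq_zero.mp (ih _ h1 k hk)).resolve_right (sub_ne_zero.2 hz)
    intro k hk
    rcases Finset.mem_insert.1 hk with rfl | hk
    · rw [Finset.sum_eq_zero fun l hl => by rw [ht l hl, zero_smul],
        add_zero] at hg
      exact (smul_eq_zero.mp hg).resolve_right (hw _)
    · exact ht k hk

variable {c : ℂ} {s : Fin L → ℂ} {bp bm : Boundary}

/-- The two eigenvalues are compared at z = x_j, where one vanishes and the other has no vanishing
factor. -/
theorem Generic.eigB_ne (hg : Generic c s bp bm) {h : Fin L → Bool} {y : Fin L → ℂ} {j : Fin L}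
    (hy : ∀ l, l ≠ j → ∃ b, y l = node c s l b) (hj : y j ^ 2 ≠ pt c s h j ^ 2) :
    ∃ z, eigB c bp bm y z ≠ eigB c bp bm (pt c s h) z := by
  refine ⟨pt c s h j, ?_⟩
  rw [eigB_eq_zero (x := pt c s h) rfl, eigB]
  refine mul_ne_zero (mul_ne_zero hg.leadB_ne (hg.node_sub_ne _ _))
    (Finset.prod_ne_zero_iff.2 fun l _ => sub_ne_zero.2 ?_)
  by_cases hl : l = j
  · exact hl ▸ hj.symm
  · obtain ⟨b, hb⟩ := hy l hl
    rw [hb]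
    exact hg.node_sq_ne (Ne.symm hl) _ _

theorem Generic.node_sq_ne_not (hg : Generic c s bp bm) (hc : c ≠ 0) (j : Fin L) (b : Bool) :
    node c s j b ^ 2 ≠ node c s j (!b) ^ 2 := by
  have key : node c s j true ^ 2 ≠ node c s j false ^ 2 := by
    intro h
    rw [node_true_eq] at h
    exact mul_ne_zero (I_mul_ne hc) (hg.node_add_ne j false) (by linear_combination h)
  cases b
  · exact key.symm
  · exact key

theorem Generic.eigB_pt_ne (hg : Generic c s bp bm) (hc : c ≠ 0) {h h' : Fin L → Bool}
    (hh : h ≠ h') : ∃ z, eigB c bp bm (pt c s h) z ≠ eigB c bp bm (pt c s h') z := by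
  obtain ⟨j, hj⟩ := Function.ne_iff.1 hh
  refine hg.eigB_ne (j := j) (fun l _ => ⟨h l, rfl⟩) ?_
  have : h' j = !h j := by
    revert hj; cases h j <;> cases h' j <;> simp
  rw [pt, pt, this]
  exact hg.node_sq_ne_not hc j _

theorem IsCovectorBasis.linearIndependent (hg : Generic c s bp bm) (hc : c ≠ 0)
    {v : (Fin L → Bool) → Space L} (hv : IsCovectorBasis c s bp bm Finset.univ v) :
    LinearIndependent ℂ v :=
  linearIndependent_of_eigenvalues (fun z => (opB c s bp bm z).vecMulLinear)
    (fun h z => eigB c bp bm (pt c s h) z) v (fun h => hv.ne h (by simp))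
    (fun h z => hv.eig h (by simp) z) fun _ _ => hg.eigB_pt_ne hc

/-- A nonzero eigencovector with a zero off the lattice would be a (2^L + 1)-st independent vector
in a space of dimension 2^L. -/
theorem IsCovectorBasis.eq_zero (hg : Generic c s bp bm) (hc : c ≠ 0)
    {v : (Fin L → Bool) → Space L} (hv : IsCovectorBasis c s bp bm Finset.univ v)
    {φ : Space L} {y : Fin L → ℂ} (hφ : IsEigencovector c s bp bm φ y) {j : Fin L}
    (hy : ∀ l, l ≠ j → ∃ b, y l = node c s l b) (hj : ∀ b, y j ^ 2 ≠ node c s j b ^ 2) :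
    φ = 0 := by
  by_contra h0
  have hli : LinearIndependent ℂ fun o : Option (Fin L → Bool) => o.elim φ v := by
    refine linearIndependent_of_eigenvalues (fun z => (opB c s bp bm z).vecMulLinear)
      (fun o z => o.elim (eigB c bp bm y z) fun h => eigB c bp bm (pt c s h) z) _ ?_ ?_ ?_
    · rintro (_ | h)
      exacts [h0, hv.ne h (by simp)]
    · rintro (_ | h) z
      exacts [hφ z, hv.eig h (by simp) z]
    · rintro (_ | h) (_ | h') hne
      · exact absurd rfl hne
      · exact hg.eigB_ne hy (hj _)
      · obtain ⟨z, hz⟩ := hg.eigB_ne (h := h) hy (hj _)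
        exact ⟨z, hz.symm⟩
      · exact hg.eigB_pt_ne hc fun e => hne (e ▸ rfl)
  have := hli.fintype_card_le_finrank
  simp at this

/-- From the lower node x, 𝒜(x) would move the zero to x - η. Its square differs from both node
squares since 2x ≠ η and x ≠ 0. -/
theorem IsCovectorBasis.vecMul_node_false (hg : Generic c s bp bm) (hc : c ≠ 0)
    (hp : bp.Admissible) (hm : bm.Admissible)
    {v : (Fin L → Bool) → Space L} (hv : IsCovectorBasis c s bp bm Finset.univ v)
    {h : Fin L → Bool} {j : Fin L} (hj : h j = false) :
    Matrix.vecMul (v h) (opA c s bp bm (node c s j false)) = 0 := by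
  refine hv.eq_zero hg hc ((hv.eig h (by simp)).vecMul_opA hp hm (j := j)
    (y := node c s j false - I * c) (by rw [pt, hj]) rfl) (j := j)
    (fun l hl => ⟨h l, by rw [Function.update_of_ne hl, pt]⟩) fun b hb => ?_
  rw [Function.update_self] at hb
  have hI := I_mul_ne hc
  cases b
  · exact mul_ne_zero hI (hg.node_sub_ne j false) (by linear_combination -hb)
  · rw [node_true_eq] at hb
    exact mul_ne_zero (mul_ne_zero (by norm_num : (4 : ℂ) ≠ 0) hI) (hg.node_ne_zero j false)
      (by linear_combination -hb)

theorem IsCovectorBasis.vecMul_neg_node_true (hg : Generic c s bp bm) (hc : c ≠ 0)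
    (hp : bp.Admissible) (hm : bm.Admissible)
    {v : (Fin L → Bool) → Space L} (hv : IsCovectorBasis c s bp bm Finset.univ v)
    {h : Fin L → Bool} {j : Fin L} (hj : h j = true) :
    Matrix.vecMul (v h) (opA c s bp bm (-node c s j true)) = 0 := by
  refine hv.eq_zero hg hc ((hv.eig h (by simp)).vecMul_opA hp hm (j := j)
    (y := node c s j true + I * c) (by rw [pt, hj, neg_sq]) (by ring)) (j := j)
    (fun l hl => ⟨h l, by rw [Function.update_of_ne hl, pt]⟩) fun b hb => ?_
  rw [Function.update_self] at hb
  have hI := I_mul_ne hc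
  cases b
  · have e : node c s j false = node c s j true - I * c := by rw [node_true_eq]; ring
    rw [e] at hb
    exact mul_ne_zero (mul_ne_zero (by norm_num : (4 : ℂ) ≠ 0) hI) (hg.node_ne_zero j true)
      (by linear_combination hb)
  · exact mul_ne_zero hI (hg.node_add_ne j true) (by linear_combination hb)

/-- Lowering is computed as the inverse of raising: 𝒜(-x) followed by 𝒜(η + x) is the scalar Δ⁻(-x)
Δ⁻(η + x), with x the lower node. -/
theorem IsCovectorBasis.lower (hg : Generic c s bp bm) (hc : c ≠ 0)
    (hp : bp.Admissible) (hm : bm.Admissible)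
    {v : (Fin L → Bool) → Space L} (hv : IsCovectorBasis c s bp bm Finset.univ v)
    {h : Fin L → Bool} {j : Fin L} (hj : h j = true) :
    Matrix.vecMul (v h) (opA c s bp bm (node c s j true))
      = Δm c s bm (node c s j true) • v (Function.update h j false) := by
  have hd := hg.Δm_neg_node_ne hc hm j
  have e1 := hv.raise (Function.update h j false) (by simp) j (Finset.mem_univ j)
    (Function.update_self _ _ _)
  rw [Function.update_idem, ← hj, Function.update_eq_self] at e1
  have e : I * c - -node c s j false = node c s j true := by rw [node_true_eq]; ring
  have e2 := (hv.eig (Function.update h j false) (by simp)).vecMul_opA_opA hp hm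
    (μ := -node c s j false) (j := j) (by rw [pt, Function.update_self, neg_sq])
  rw [e1, e, Matrix.smul_vecMul, mul_smul] at e2
  exact smul_right_injective _ hd e2

end Independence

/-! ### The separating isomorphism -/

section Transform

variable {c : ℂ} {s : Fin L → ℂ} {bp bm : Boundary}

/-- Distinct labels give distinct numbers, so prescribing values at labelled nodes defines a single
function Q on ℂ. -/
theorem node_injective (hg : Generic c s bp bm) (hc : c ≠ 0) :
    Function.Injective fun p : Fin L × Bool => node c s p.1 p.2 := by
  rintro ⟨j, b⟩ ⟨l, b'⟩ h
  simp only at h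
  by_cases hjl : j = l
  · subst hjl
    by_cases hb : b' = !b
    · subst hb
      exact absurd (by rw [h]) (hg.node_sq_ne_not hc j b)
    · cases b <;> cases b' <;> simp_all
  · exact absurd (by rw [h]) (hg.node_sq_ne hjl b b')

theorem mem_nodes_iff {j : Fin L} {x : ℂ} : x ∈ nodes c s j ↔ ∃ b, x = node c s j b := by
  simp [nodes, node, or_comm]

theorem node_true_ne (hc : c ≠ 0) (j : Fin L) : node c s j true ≠ node c s j false := fun h =>
  I_mul_ne hc (by rw [node_true_eq] at h; linear_combination h)

/-- The lattice is indexed by the choices of a node at each site. -/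
def gridEquiv (s : Fin L → ℂ) (hc : c ≠ 0) : (Fin L → Bool) ≃ grid c s :=
  Equiv.ofBijective (fun h => ⟨pt c s h, fun l => node_mem l (h l)⟩) <| by
    constructor
    · intro h h' e
      funext l
      have e1 : node c s l (h l) = node c s l (h' l) := congrFun (Subtype.ext_iff.1 e) l
      revert e1
      cases h l <;> cases h' l
      exacts [fun _ => rfl, fun e => absurd e.symm (node_true_ne hc l),
        fun e => absurd e (node_true_ne hc l), fun _ => rfl]
    · rintro ⟨x, hx⟩
      choose b hb using fun l => mem_nodes_iff.1 (hx l)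
      exact ⟨b, Subtype.ext (funext fun l => (hb l).symm)⟩

theorem gridEquiv_coe (hc : c ≠ 0) (h : Fin L → Bool) :
    (gridEquiv s hc h : Fin L → ℂ) = pt c s h := rfl

theorem eq_zero_of_dotProduct {v : (Fin L → Bool) → Space L} (hv : LinearIndependent ℂ v)
    {ψ : Space L} (h : ∀ k, v k ⬝ᵥ ψ = 0) : ψ = 0 := by
  have hspan := hv.span_eq_top_of_card_eq_finrank (by simp)
  have h0 : ∀ φ : Space L, φ ⬝ᵥ ψ = 0 := by
    intro φ
    have hφ : φ ∈ Submodule.span ℂ (Set.range v) := hspan ▸ Submodule.mem_top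
    induction hφ using Submodule.span_induction with
    | mem x hx => obtain ⟨k, rfl⟩ := hx; exact h k
    | zero => exact zero_dotProduct _
    | add x y _ _ hx hy => rw [add_dotProduct, hx, hy, add_zero]
    | smul a x _ hx => rw [smul_dotProduct, hx, smul_zero]
  exact funext fun a => by simpa using h0 (Pi.single a 1)

/-- The coefficients of a vector with respect to a basis of covectors, as a function on the
lattice. -/
def separation (hc : c ≠ 0) {v : (Fin L → Bool) → Space L} (hv : LinearIndependent ℂ v) :
    Space L ≃ₗ[ℂ] (grid c s → ℂ) :=
  (LinearMap.linearEquivOfInjective (Matrix.mulVecLin (Matrix.of v))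
    ((injective_iff_map_eq_zero _).2 fun _ h => eq_zero_of_dotProduct hv (congrFun h))
    (by simp)).trans (LinearEquiv.funCongrLeft ℂ ℂ (gridEquiv s hc).symm)

theorem separation_apply (hc : c ≠ 0) {v : (Fin L → Bool) → Space L}
    (hv : LinearIndependent ℂ v) (ψ : Space L) (h : Fin L → Bool) :
    separation hc hv ψ (gridEquiv s hc h) = v h ⬝ᵥ ψ := by
  simp [separation, Matrix.mulVec]

theorem shifted_eq (hc : c ≠ 0) (f : grid c s → ℂ) (h : Fin L → Bool) (j : Fin L) {d : ℂ}
    (b : Bool) (hd : node c s j (h j) + d = node c s j b) :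
    shifted j d f (gridEquiv s hc h) = f (gridEquiv s hc (Function.update h j b)) := by
  have e : Function.update (gridEquiv s hc h).1 j ((gridEquiv s hc h).1 j + d)
      = pt c s (Function.update h j b) := by
    rw [pt_update]
    exact congrArg _ hd
  have hmem : Function.update (gridEquiv s hc h).1 j ((gridEquiv s hc h).1 j + d) ∈ grid c s := by
    rw [e]
    exact fun l => node_mem l _
  rw [shifted, dif_pos hmem]
  exact congrArg f (Subtype.ext e)

theorem Δp_node_true (j : Fin L) : Δp c s bm (node c s j true) = 0 := by
  rw [Δp_eq, Δm_neg_node_true, mul_zero]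

theorem isSeparated (hg : Generic c s bp bm) (hc : c ≠ 0) (hp : bp.Admissible)
    (hm : bm.Admissible) {v : (Fin L → Bool) → Space L}
    (hv : IsCovectorBasis c s bp bm Finset.univ v) :
    IsSeparated c s bp bm (separation hc (hv.linearIndependent hg hc)) := by
  have hA : ∀ (M : Op L) (ψ : Space L) h, separation hc (hv.linearIndependent hg hc)
      (M.mulVec ψ) (gridEquiv s hc h) = Matrix.vecMul (v h) M ⬝ᵥ ψ := by
    intro M ψ h
    rw [separation_apply, Matrix.dotProduct_mulVec]
  constructor
  · intro z ψ x
    obtain ⟨h, rfl⟩ := (gridEquiv s hc).surjective x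
    rw [hA, hv.eig h (by simp), smul_dotProduct, separation_apply]
    rfl
  · intro ψ x j
    obtain ⟨h, rfl⟩ := (gridEquiv s hc).surjective x
    rw [hA, gridEquiv_coe, pt]
    cases hj : h j
    · rw [hv.vecMul_node_false hg hc hp hm hj, Δm_node_false, zero_mul, zero_dotProduct]
    · rw [hv.lower hg hc hp hm hj, shifted_eq hc _ h j false (by rw [hj, node_true_eq]; ring),
        separation_apply, smul_dotProduct, smul_eq_mul]
  · intro ψ x j
    obtain ⟨h, rfl⟩ := (gridEquiv s hc).surjective x
    -- By parity 𝒟~(x) acts as 𝒜(-x): this raises from the lower node and vanishes at the upper one.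
    rw [opDt_eq c s hp, Matrix.smul_mulVec, map_smul, Pi.smul_apply, hA, gridEquiv_coe, pt]
    cases hj : h j
    · rw [hv.raise h (by simp) j (Finset.mem_univ j) hj, shifted_eq hc _ h j true
        (by rw [hj, node_true_eq]), separation_apply, smul_dotProduct, smul_eq_mul, smul_eq_mul,
        Δp_eq, mul_assoc]
    · rw [hv.vecMul_neg_node_true hg hc hp hm hj, Δp_node_true, zero_mul, zero_dotProduct,
        smul_zero]

end Transform

/-! ### Product functions, and the transfer matrix in terms of 𝒜 and 𝒟~ -/

section Product

/-- A function on a cube with constant ratios along each direction is a product. -/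
theorem eq_prod_of_ratio {ι K : Type*} [Fintype ι] [DecidableEq ι] [CommRing K]
    (F : (ι → Bool) → K) (g : ι → Bool → K) (b : ι → Bool)
    (hF : ∀ h j, F h = g j (h j) * F (Function.update h j (b j))) (h : ι → Bool) :
    F h = (∏ l, g l (h l)) * F b := by
  have key : ∀ S : Finset ι, F h = (∏ l ∈ S, g l (h l)) * F (S.piecewise b h) := by
    intro S
    induction S using Finset.induction_on with
    | empty => simp
    | insert j S hj ih =>
      rw [ih, hF (S.piecewise b h) j, Finset.piecewise_insert, Finset.prod_insert hj,
        Finset.piecewise_eq_of_notMem _ _ _ hj]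
      ring
  simpa using key Finset.univ

variable {c : ℂ} {s : Fin L → ℂ} {bp bm : Boundary}

/-- In the eigenbasis of K⁺ only 𝒜 and 𝒟 enter the trace; solving the definition of 𝒟~ for 𝒟 divides
by 2z. -/
theorem τ_eq (hp : bp.Admissible) {z : ℂ} (hz : z ≠ 0) :
    τ c s bp bm z = ((z + I * c / 2) * (z + bp.α - I * c / 2) / (2 * z * bp.α)) • opA c s bp bm z
      - ((z - bp.α + I * c / 2) / (4 * z * bp.α)) • opDt c s bp bm z := by
  have hα := hp.α_ne
  have hD : opDt c s bp bm z
      = (2 * z) • U c s bp bm z 1 1 - (I * c) • opA c s bp bm z := rfl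
  have hU : (scal (bp.K (z + I * c / 2)) * dress c bm (T c s) z).trace
      = (1 + (z + I * c / 2) / bp.α) • opA c s bp bm z
        + (1 - (z + I * c / 2) / bp.α) • U c s bp bm z 1 1 := by
    have hG : bp.G * bp.Ginv = 1 := mul_eq_one_comm.mp hp.Ginv_mul
    have h1 : (num bp.G * U c s bp bm z * num bp.Ginv : AuxOp L) = dress c bm (T c s) z := by
      have e : (num bp.G * num bp.Ginv : AuxOp L) = 1 := by rw [← map_mul, hG, map_one]
      rw [dress_T, U_eq c s hp]
      simp only [mul_assoc, e, mul_one]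
      rw [← mul_assoc, e, one_mul]
    have h2 : bp.Ginv * bp.K (z + I * c / 2) * bp.G
        = !![1 + (z + I * c / 2) / bp.α, 0; 0, 1 - (z + I * c / 2) / bp.α] := by
      rw [Boundary.K_eq, mul_add, mul_one, add_mul, hp.Ginv_mul, mul_smul_comm, smul_mul_assoc,
        hp.Ginv_N_G]
      ext i j
      fin_cases i <;> fin_cases j <;> simp <;> ring
    rw [← h1, scal_eq_num, ← mul_assoc, ← trace_num_mul, ← mul_assoc, ← mul_assoc, ← map_mul,
      ← map_mul, h2]
    simp [Matrix.trace_fin_two, Matrix.mul_apply, Fin.sum_univ_two, num_apply,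
      Algebra.algebraMap_eq_smul_one, opA]
  rw [τ, hU, hD]
  match_scalars <;> field_simp <;> ring

end Product

/-! ### Product form of eigenfunctions and the TQ-equation -/

section Eigenfunctions

variable {c : ℂ} {s : Fin L → ℂ} {bp bm : Boundary}

/-- The coefficient of `Q(z - i c)` in the TQ-equation. -/
def coefm (c : ℂ) (s : Fin L → ℂ) (bp bm : Boundary) (z : ℂ) : ℂ :=
  (z + I * c / 2) * (z + bp.α - I * c / 2) / (2 * z * bp.α) * Δm c s bm z

/-- Minus the coefficient of `Q(z + i c)` in the TQ-equation. -/
def coefp (c : ℂ) (s : Fin L → ℂ) (bp bm : Boundary) (z : ℂ) : ℂ :=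
  (z - bp.α + I * c / 2) / (4 * z * bp.α) * Δp c s bm z

/-- The K⁺-dependent factors that may vanish are s_j + α⁺ and s_j - α⁺; they cannot vanish together
because α⁺ ≠ 0. -/
theorem Generic.coef_ne (hg : Generic c s bp bm) (hc : c ≠ 0) (hp : bp.Admissible)
    (hm : bm.Admissible) (j : Fin L) :
    coefm c s bp bm (node c s j true) ≠ 0 ∨ coefp c s bp bm (node c s j false) ≠ 0 := by
  have hα := hp.α_ne
  by_cases h : node c s j true + bp.α - I * c / 2 = 0
  · right
    have h1 : node c s j false - bp.α + I * c / 2 = -(2 * bp.α) := by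
      rw [node_true_eq] at h
      linear_combination h
    rw [coefp, h1, Δp_eq]
    refine mul_ne_zero (div_ne_zero (neg_ne_zero.2 (mul_ne_zero two_ne_zero hα)) ?_)
      (mul_ne_zero (hg.node_sub_ne j false) (hg.Δm_neg_node_ne hc hm j))
    exact mul_ne_zero (mul_ne_zero (by norm_num) (hg.node_ne_zero j false)) hα
  · left
    refine mul_ne_zero (div_ne_zero (mul_ne_zero ?_ h) ?_) (hg.Δm_node_ne hc hm j)
    · intro h1
      exact hg.node_add_ne j true (by linear_combination 2 * h1)
    · exact mul_ne_zero (mul_ne_zero two_ne_zero (hg.node_ne_zero j true)) hα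

variable {Φ : Space L ≃ₗ[ℂ] (grid c s → ℂ)} {Λ : ℂ → ℂ} {ψ : Space L}

theorem IsSeparated.eigen_apply (hΦ : IsSeparated c s bp bm Φ) (hg : Generic c s bp bm)
    (hp : bp.Admissible) (hψ : IsEigenpair c s bp bm Λ ψ) (x : grid c s) (j : Fin L) :
    Λ (x.1 j) * Φ ψ x = coefm c s bp bm (x.1 j) * shifted j (-(I * c)) (Φ ψ) x
      - coefp c s bp bm (x.1 j) * shifted j (I * c) (Φ ψ) x := by
  have hx := (hg.nodes_ne j _ (x.2 j)).1
  have e := congrFun (congrArg Φ (hψ.2 (x.1 j))) x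
  rw [τ_eq hp hx, Matrix.sub_mulVec, Matrix.smul_mulVec, Matrix.smul_mulVec, map_sub, map_smul,
    map_smul, map_smul, Pi.sub_apply, Pi.smul_apply, Pi.smul_apply, Pi.smul_apply, hΦ.A_apply,
    hΦ.Dt_apply, smul_eq_mul, smul_eq_mul, smul_eq_mul] at e
  rw [coefm, coefp, ← e]
  ring

theorem coefm_node_false (j : Fin L) : coefm c s bp bm (node c s j false) = 0 := by
  rw [coefm, Δm_node_false, mul_zero]

theorem coefp_node_true (j : Fin L) : coefp c s bp bm (node c s j true) = 0 := by
  rw [coefp, Δp_node_true, mul_zero]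

theorem IsSeparated.eigen_true (hΦ : IsSeparated c s bp bm Φ) (hg : Generic c s bp bm)
    (hc : c ≠ 0) (hp : bp.Admissible) (hψ : IsEigenpair c s bp bm Λ ψ) {h : Fin L → Bool}
    {j : Fin L} (hj : h j = true) :
    Λ (node c s j true) * Φ ψ (gridEquiv s hc h) = coefm c s bp bm (node c s j true)
      * Φ ψ (gridEquiv s hc (Function.update h j false)) := by
  have e := hΦ.eigen_apply hg hp hψ (gridEquiv s hc h) j
  rw [gridEquiv_coe, pt, hj, coefp_node_true, zero_mul, sub_zero,
    shifted_eq hc _ h j false (by rw [hj, node_true_eq]; ring)] at e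
  exact e

theorem IsSeparated.eigen_false (hΦ : IsSeparated c s bp bm Φ) (hg : Generic c s bp bm)
    (hc : c ≠ 0) (hp : bp.Admissible) (hψ : IsEigenpair c s bp bm Λ ψ) {h : Fin L → Bool}
    {j : Fin L} (hj : h j = false) :
    Λ (node c s j false) * Φ ψ (gridEquiv s hc h) = -coefp c s bp bm (node c s j false)
      * Φ ψ (gridEquiv s hc (Function.update h j true)) := by
  have e := hΦ.eigen_apply hg hp hψ (gridEquiv s hc h) j
  rw [gridEquiv_coe, pt, hj, coefm_node_false, zero_mul, zero_sub,
    shifted_eq hc _ h j true (by rw [hj, node_true_eq]), ← neg_mul] at e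
  exact e

/-- Whichever recurrence has a nonzero coefficient expresses the value at one node through the value
at the other, with a ratio independent of the remaining variables. The base node `b` is the one
divided from. -/
theorem IsSeparated.exists_ratio (hΦ : IsSeparated c s bp bm Φ) (hg : Generic c s bp bm)
    (hc : c ≠ 0) (hp : bp.Admissible) (hm : bm.Admissible) (hψ : IsEigenpair c s bp bm Λ ψ)
    (j : Fin L) : ∃ (b : Bool) (g : Bool → ℂ), ∀ h, Φ ψ (gridEquiv s hc h)
      = g (h j) * Φ ψ (gridEquiv s hc (Function.update h j b)) := by
  rcases hg.coef_ne hc hp hm j with h0 | h0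
  · refine ⟨true, fun b => if b then 1 else
      Λ (node c s j true) / coefm c s bp bm (node c s j true), fun h => ?_⟩
    cases hj : h j
    · have e := hΦ.eigen_true hg hc hp hψ (Function.update_self j true h)
      rw [Function.update_idem, ← hj, Function.update_eq_self] at e
      simp only [Bool.false_eq_true, if_false]
      rw [div_mul_eq_mul_div, e, mul_div_cancel_left₀ _ h0]
    · rw [← hj, Function.update_eq_self, hj]
      simp only [if_true, one_mul]
  · refine ⟨false, fun b => if b then
      Λ (node c s j false) / -coefp c s bp bm (node c s j false) else 1, fun h => ?_⟩
    cases hj : h j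
    · rw [← hj, Function.update_eq_self, hj]
      simp only [Bool.false_eq_true, if_false, one_mul]
    · have e := hΦ.eigen_false hg hc hp hψ (Function.update_self j false h)
      rw [Function.update_idem, ← hj, Function.update_eq_self] at e
      simp only [if_true]
      rw [div_mul_eq_mul_div, e, mul_div_cancel_left₀ _ (neg_ne_zero.2 h0)]

theorem IsSeparated.exists_prod (hΦ : IsSeparated c s bp bm Φ) (hL : 0 < L)
    (hg : Generic c s bp bm) (hc : c ≠ 0) (hp : bp.Admissible) (hm : bm.Admissible)
    (hψ : IsEigenpair c s bp bm Λ ψ) :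
    ∃ Q : ℂ → ℂ, ∀ h, Φ ψ (gridEquiv s hc h) = ∏ l, Q (node c s l (h l)) := by
  choose b g hbg using hΦ.exists_ratio hg hc hp hm hψ
  have hF := eq_prod_of_ratio (fun h => Φ ψ (gridEquiv s hc h)) g b fun h j => hbg j h
  set κ := Φ ψ (gridEquiv s hc b)
  -- The overall constant `κ` has to be absorbed into the factor of one site; this is where L > 0
  -- enters.
  let l₀ : Fin L := ⟨0, hL⟩
  refine ⟨Function.extend (fun p : Fin L × Bool => node c s p.1 p.2)
    (fun p => (if p.1 = l₀ then κ else 1) * g p.1 p.2) 0, fun h => ?_⟩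
  have hQ : ∀ l, Function.extend (fun p : Fin L × Bool => node c s p.1 p.2)
      (fun p => (if p.1 = l₀ then κ else 1) * g p.1 p.2) 0 (node c s l (h l))
      = (if l = l₀ then κ else 1) * g l (h l) := fun l =>
    (node_injective hg hc).extend_apply _ _ (l, h l)
  simp only [hQ, Finset.prod_mul_distrib, Finset.prod_ite_eq', Finset.mem_univ, if_true]
  rw [mul_comm]
  exact hF h

/-- At a lattice point where Φψ ≠ 0 the factors of the other variables are nonzero and cancel from
the recurrence. The value of Q off the nodes of site `j` is irrelevant, its coefficient being 0. -/
theorem IsSeparated.tq (hΦ : IsSeparated c s bp bm Φ) (hg : Generic c s bp bm) (hc : c ≠ 0)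
    (hp : bp.Admissible) (hψ : IsEigenpair c s bp bm Λ ψ) {Q : ℂ → ℂ}
    (hQ : ∀ h, Φ ψ (gridEquiv s hc h) = ∏ l, Q (node c s l (h l))) (j : Fin L) (b : Bool) :
    Λ (node c s j b) * Q (node c s j b)
      = coefm c s bp bm (node c s j b) * Q (node c s j b - I * c)
        - coefp c s bp bm (node c s j b) * Q (node c s j b + I * c) := by
  obtain ⟨x, hx⟩ := Function.ne_iff.1 (Φ.map_ne_zero_iff.2 hψ.1)
  obtain ⟨h, rfl⟩ := (gridEquiv s hc).surjective x
  rw [Pi.zero_apply, hQ, ← Finset.mul_prod_erase _ _ (Finset.mem_univ j)] at hx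
  have hR := right_ne_zero_of_mul hx
  have hup : ∀ b, Φ ψ (gridEquiv s hc (Function.update h j b)) = Q (node c s j b)
      * ∏ l ∈ Finset.univ.erase j, Q (node c s l (h l)) := by
    intro b
    rw [hQ, ← Finset.mul_prod_erase _ _ (Finset.mem_univ j), Function.update_self]
    congr 1
    exact Finset.prod_congr rfl fun l hl => by rw [Function.update_of_ne (Finset.ne_of_mem_erase hl)]
  cases b
  · have e := hΦ.eigen_false hg hc hp hψ (Function.update_self j false h)
    rw [Function.update_idem, hup, hup] at e
    rw [coefm_node_false, zero_mul, zero_sub, ← node_true_eq]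
    exact mul_right_cancel₀ hR (by linear_combination e)
  · have e := hΦ.eigen_true hg hc hp hψ (Function.update_self j true h)
    have e1 : node c s j true - I * c = node c s j false := by rw [node_true_eq]; ring
    rw [Function.update_idem, hup, hup] at e
    rw [coefp_node_true, zero_mul, sub_zero, e1]
    exact mul_right_cancel₀ hR (by linear_combination e)

end Eigenfunctions

end OpenXXX

end

theorem mainTheorem4 {L : ℕ} (hL : 0 < L) (c : ℂ) (hc : c ≠ 0) (s : Fin L → ℂ)
    (bp bm : OpenXXX.Boundary) (hp : bp.Admissible) (hm : bm.Admissible) :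
    -- `Δ_q` is the quantum determinant
    (∀ z, OpenXXX.qdetOp c s bp bm z = OpenXXX.Δq c s bm z • (1 : OpenXXX.Op L)) ∧
    -- separation of variables, product eigenfunctions and the TQ-equation
    (OpenXXX.Generic c s bp bm →
      ∃ Φ : OpenXXX.Space L ≃ₗ[ℂ] (OpenXXX.grid c s → ℂ),
        OpenXXX.IsSeparated c s bp bm Φ ∧
        ∀ (Λ : ℂ → ℂ) (ψ : OpenXXX.Space L), OpenXXX.IsEigenpair c s bp bm Λ ψ →
          ∃ Q : ℂ → ℂ,
            (∀ x : OpenXXX.grid c s, Φ ψ x = ∏ l, Q (x.1 l)) ∧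
            ∀ j, ∀ x ∈ OpenXXX.nodes c s j,
              Λ x * Q x =
                (x + Complex.I * c / 2) * (x + bp.α - Complex.I * c / 2) / (2 * x * bp.α)
                    * OpenXXX.Δm c s bm x * Q (x - Complex.I * c)
                  - (x - bp.α + Complex.I * c / 2) / (4 * x * bp.α)
                    * OpenXXX.Δp c s bm x * Q (x + Complex.I * c)) ∧
    -- the functional equations
    (∀ (Λ : ℂ → ℂ) (ψ : OpenXXX.Space L), OpenXXX.IsEigenpair c s bp bm Λ ψ →
      ∀ j, 2 * s j - Complex.I * c ≠ 0 → 2 * s j + Complex.I * c ≠ 0 →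
        Λ (s j + Complex.I * c / 2) * Λ (s j - Complex.I * c / 2) =
          -((s j + Complex.I * c) / 2)
            * ((s j - bp.α) / ((2 * s j - Complex.I * c) * bp.α))
            * ((s j + bp.α) / ((2 * s j + Complex.I * c) * bp.α))
            * OpenXXX.Δq c s bm (s j)) := by
  refine ⟨OpenXXX.qdetOp_eq c s hp hm, fun hg => ?_, fun Λ ψ h j h1 h2 =>
    OpenXXX.eigenvalue_mul c s hp hm h j h1 h2⟩
  obtain ⟨v, hv⟩ := hg.exists_covectorBasis hc hp hm Finset.univ
  have hΦ := OpenXXX.isSeparated hg hc hp hm hv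
  refine ⟨_, hΦ, fun Λ ψ hψ => ?_⟩
  obtain ⟨Q, hQ⟩ := hΦ.exists_prod hL hg hc hp hm hψ
  refine ⟨Q, fun x => ?_, fun j x hx => ?_⟩
  · obtain ⟨h, rfl⟩ := (OpenXXX.gridEquiv s hc).surjective x
    exact hQ h
  · obtain ⟨b, rfl⟩ := OpenXXX.mem_nodes_iff.1 hx
    exact hΦ.tq hg hc hp hψ hQ j b
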